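/- Let $A=\{a,b\}$, let $A^+$ be the free semigroup on $A$, and let $\tau$ be the Prouhet–Thue–Morse substitution, the endomorphism of $A^+$ with $\tau(a)=ab$, $\tau(b)=ba$. Let $\overline\Omega_A\mathsf S$ be the free profinite semigroup on $A$ (the inverse limit of the finite quotients of $A^+$), and denote again by $\tau$ the continuous extension of $\tau$ to $\overline\Omega_A\mathsf S$. For a continuous endomorphism $f$ of $\overline\Omega_A\mathsf S$, or of a free profinite group on a finite set, let $f^\omega$ be the pointwise limit of the iterates $f^{n!}$; it exists and is a continuous endomorphism. Let $L(\tau)$ be the set of nonempty words that are factors of $\tau^k(c)$, $c\in A$, for arbitrarily large $k$ (the language of the Prouhet–Thue–Morse subshift), and let $J(\tau)=\overline{L(\tau)}\setminus L(\tau)$, the closure being taken in $\overline\Omega_A\mathsf S$. Let the Schützenberger group $G(\tau)$ be the intersection of the $\mathcal R$-class and the $\mathcal L$-class of $\tau^\omega(a)$ in $\overline\Omega_A\mathsf S$. Then $G(\tau)$ is a maximal subgroup of $\overline\Omega_A\mathsf S$ contained in $J(\tau)$; it is a profinite group for the induced topology, and $\tau^2$ restricts to a continuous automorphism $\psi$ of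 $G(\tau)$. Let $F$ be the free profinite group on $\{\alpha,\beta,\gamma\}$. There is a (necessarily unique) continuous homomorphism $\pi\colon F\to G(\tau)$ with $$\pi(\alpha)=\tau^\omega(abba),\qquad \pi(\beta)=\tau^\omega(ababba),\qquad \pi(\gamma)=\tau^\omega(abbaba),$$ and it is onto. Let $\Psi$ be the continuous endomorphism of $F$ with $$\Psi(\alpha)=\gamma\alpha\beta,\qquad \Psi(\beta)=\gamma\beta\alpha^{-1}\gamma\alpha\beta,\qquad \Psi(\gamma)=\gamma\alpha\beta\alpha^{-1}\gamma\beta.$$ Then $\Psi$ belongs to the set $L_\psi(\pi)$ of those continuous endomorphisms $\Phi$ of $F$ for which $\pi\circ\Phi=\psi\circ\pi$ and $\operatorname{Ker}\pi\subseteq\operatorname{Ker}\Phi^\omega$. Hence the profinite group $G(\tau)$ has the presentation $$\langle \alpha,\beta,\gamma\mid \Psi^\omega(\alpha)=\alpha,\ \Psi^\omega(\beta)=\beta,\ \Psi^\omega(\gamma)=\gamma\rangle,$$ that is, $\pi$ is onto and $\operatorname{Ker}\pi$ is the topological closure of the normal closure in $F$ of $\{\Psi^\omega(x)x^{-1} :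 x\in\{\alpha,\beta,\gamma\}\}$. -/

import Mathlib

open Filter Topology

/-! ### Idempotent powers of continuous self-maps -/

/-- `g` is the `ω`-power of `f`: the pointwise limit of the iterates `f^(n!)`. In a profinite
monoid of endomorphisms this is the unique idempotent in the closed subsemigroup generated by
`f`. -/
def IsOmegaPower {S : Type*} [TopologicalSpace S] (f g : S → S) : Prop :=
  ∀ x, Tendsto (fun n : ℕ => f^[n.factorial] x) atTop (𝓝 (g x))

theorem exists_stable_factorial {S Q : Type*} (p : S → Q) (f : S → S)
    (hfin : (Set.range fun n : ℕ => p ∘ f^[n]).Finite) :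
    ∃ N : ℕ, ∀ n : ℕ, N ≤ n → p ∘ f^[n.factorial] = p ∘ f^[N.factorial] := by
  have hni : ¬ Function.Injective (fun n : ℕ => p ∘ f^[n]) := fun h =>
    Set.infinite_range_of_injective h hfin
  obtain ⟨i, d, hd, hid⟩ : ∃ i d, 0 < d ∧ p ∘ f^[i + d] = p ∘ f^[i] := by
    simp only [Function.Injective, not_forall] at hni
    obtain ⟨i, j, h, hij⟩ := hni
    rcases lt_or_gt_of_ne hij with hlt | hlt
    · exact ⟨i, j - i, by omega, by rw [Nat.add_sub_cancel' hlt.le]; exact h.symm⟩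
    · exact ⟨j, i - j, by omega, by rw [Nat.add_sub_cancel' hlt.le]; exact h⟩
  have h1 : ∀ n, i ≤ n → p ∘ f^[n + d] = p ∘ f^[n] := by
    intro n hn
    obtain ⟨k, rfl⟩ := Nat.exists_eq_add_of_le hn
    have e : i + k + d = (i + d) + k := by omega
    rw [e, Function.iterate_add f (i + d) k, Function.iterate_add f i k, ← Function.comp_assoc,
      hid, Function.comp_assoc]
  have h2 : ∀ m n, i ≤ n → p ∘ f^[n + d * m] = p ∘ f^[n] := by
    intro m n hn
    induction m with
    | zero => rfl
    | succ m ih =>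
      rw [Nat.mul_succ, ← Nat.add_assoc, h1 _ (by omega), ih]
  refine ⟨i + d, fun n hn => ?_⟩
  have hle : (i + d).factorial ≤ n.factorial := Nat.factorial_le hn
  have hdvd : d ∣ n.factorial - (i + d).factorial :=
    Nat.dvd_sub (Nat.dvd_factorial hd (by omega)) (Nat.dvd_factorial hd (by omega))
  obtain ⟨m, hm⟩ := hdvd
  have e : n.factorial = (i + d).factorial + d * m := by omega
  rw [e, h2 m _ (le_trans (by omega) (Nat.self_le_factorial (i + d)))]

theorem exists_isOmegaPower {S : Type*} [TopologicalSpace S] [CompactSpace S] {I : Type*}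
    {Q : I → Type*} [∀ i, TopologicalSpace (Q i)] [∀ i, T2Space (Q i)] (p : ∀ i, S → Q i)
    (hp : ∀ i, Continuous (p i)) (hsep : ∀ x y, (∀ i, p i x = p i y) → x = y)
    (f : S → S) (hf : Continuous f) (hfin : ∀ i, (Set.range fun n : ℕ => p i ∘ f^[n]).Finite) :
    ∃ g : S → S, Continuous g ∧ IsOmegaPower f g := by
  have hemb : IsClosedEmbedding (fun (x : S) i => p i x) :=
    (continuous_pi hp).isClosedEmbedding fun x y h => hsep x y fun i => congrFun h i
  choose N hN using fun i => exists_stable_factorial (p i) f (hfin i)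
  have hlim : ∀ x, Tendsto (fun n : ℕ => fun i => p i (f^[n.factorial] x)) atTop
      (𝓝 fun i => p i (f^[(N i).factorial] x)) := by
    intro x
    refine tendsto_pi_nhds.2 fun i => tendsto_const_nhds.congr' ?_
    filter_upwards [eventually_ge_atTop (N i)] with n hn
    exact (congrFun (hN i n hn) x).symm
  have hmem : ∀ x, ∃ y, (fun i => p i y) = fun i => p i (f^[(N i).factorial] x) := fun x =>
    hemb.isClosed_range.mem_of_tendsto (hlim x) (Eventually.of_forall fun n => ⟨_, rfl⟩)
  choose g hg using hmem
  refine ⟨g, hemb.isInducing.continuous_iff.2 ?_, fun x => hemb.isInducing.tendsto_nhds_iff.2 ?_⟩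
  · refine continuous_pi fun i => ?_
    have : (fun x => p i (g x)) = fun x => p i (f^[(N i).factorial] x) :=
      funext fun x => congrFun (hg x) i
    exact this ▸ (hp i).comp (hf.iterate _)
  · have := hlim x
    rw [← hg x] at this
    exact this

/-! ### Free profinite semigroups -/

/-- Congruences of finite index on the free semigroup `A⁺`. -/
structure FiniteCongruence (A : Type*) where
  /-- The underlying congruence. -/
  con : Con (FreeSemigroup A)
  /-- The index is finite. -/
  finite : Finite con.Quotient

namespace FiniteCongruence

variable {A B : Type*}

/-- The finite quotient semigroup of a congruence of finite index. -/
def Quot (c : FiniteCongruence A) : Type _ := c.con.Quotient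

instance (c : FiniteCongruence A) : Semigroup c.Quot :=
  inferInstanceAs (Semigroup c.con.Quotient)

instance (c : FiniteCongruence A) : Finite c.Quot := c.finite

instance (c : FiniteCongruence A) : TopologicalSpace c.Quot := ⊥

instance (c : FiniteCongruence A) : DiscreteTopology c.Quot := ⟨rfl⟩

/-- The quotient homomorphism `A⁺ → A⁺/c`. -/
def cls (c : FiniteCongruence A) : FreeSemigroup A →ₙ* c.Quot where
  toFun w := (w : c.con.Quotient)
  map_mul' _ _ := rfl

theorem cls_surjective (c : FiniteCongruence A) : Function.Surjective c.cls :=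
  Quotient.mk''_surjective

theorem cls_eq_cls (c : FiniteCongruence A) {u v : FreeSemigroup A} :
    c.cls u = c.cls v ↔ c.con u v := c.con.eq

/-- A homomorphism `φ : A⁺ → B⁺` with `c u v → d (φ u) (φ v)` induces `A⁺/c → B⁺/d`. -/
def map (φ : FreeSemigroup A →ₙ* FreeSemigroup B) (c : FiniteCongruence A)
    (d : FiniteCongruence B) (h : ∀ u v, c.con u v → d.con (φ u) (φ v)) : c.Quot →ₙ* d.Quot where
  toFun := Quotient.map' φ h
  map_mul' x y := by
    obtain ⟨u, rfl⟩ := c.cls_surjective x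
    obtain ⟨v, rfl⟩ := c.cls_surjective y
    exact congrArg d.cls (map_mul φ u v)

theorem map_cls (φ : FreeSemigroup A →ₙ* FreeSemigroup B) (c : FiniteCongruence A)
    (d : FiniteCongruence B) (h : ∀ u v, c.con u v → d.con (φ u) (φ v)) (u : FreeSemigroup A) :
    map φ c d h (c.cls u) = d.cls (φ u) := rfl

/-- The inverse image of a finite index congruence under a homomorphism. -/
def comap (φ : FreeSemigroup A →ₙ* FreeSemigroup B) (d : FiniteCongruence B) :
    FiniteCongruence A where
  con := Con.comap φ (map_mul φ) d.con
  finite := by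
    refine Finite.of_injective (β := d.Quot)
      (fun q => Con.liftOn q (fun u => d.cls (φ u)) fun _ _ h => d.cls_eq_cls.2 h) ?_
    rintro ⟨u⟩ ⟨v⟩ h
    exact Quotient.sound' (d.cls_eq_cls.1 h)

theorem comap_rel (φ : FreeSemigroup A →ₙ* FreeSemigroup B) (d : FiniteCongruence B)
    (u v : FreeSemigroup A) : (d.comap φ).con u v ↔ d.con (φ u) (φ v) := Iff.rfl

end FiniteCongruence

/-- The free profinite semigroup on `A`: the inverse limit of the finite quotients of `A⁺`,
that is, the compatible families of elements of these quotients. -/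
@[ext]
structure FreeProfiniteSemigroup (A : Type*) where
  /-- The components in the finite quotients. -/
  val : ∀ c : FiniteCongruence A, c.Quot
  /-- Compatibility with the projections between finite quotients. -/
  compat : ∀ (c d : FiniteCongruence A) (h : ∀ u v, c.con u v → d.con u v),
    FiniteCongruence.map (MulHom.id _) c d h (val c) = val d

namespace FreeProfiniteSemigroup

variable {A B : Type*}

/-- The topology of the inverse limit of finite discrete spaces. -/
instance : TopologicalSpace (FreeProfiniteSemigroup A) :=
  TopologicalSpace.induced val inferInstance

instance : Semigroup (FreeProfiniteSemigroup A) where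
  mul x y := ⟨fun c => x.val c * y.val c,
    fun c d h => by rw [map_mul, x.compat c d h, y.compat c d h]⟩
  mul_assoc _ _ _ := FreeProfiniteSemigroup.ext (funext fun _ => mul_assoc _ _ _)

/-- The projection onto a finite quotient. -/
def proj (c : FiniteCongruence A) : FreeProfiniteSemigroup A →ₙ* c.Quot where
  toFun x := x.val c
  map_mul' _ _ := rfl

theorem isInducing_val : IsInducing (val : FreeProfiniteSemigroup A → _) := ⟨rfl⟩

theorem continuous_proj (c : FiniteCongruence A) : Continuous (proj c) :=
  (continuous_apply c).comp isInducing_val.continuous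

theorem ext_proj {x y : FreeProfiniteSemigroup A} (h : ∀ c, proj c x = proj c y) : x = y :=
  FreeProfiniteSemigroup.ext (funext h)

theorem isClosedEmbedding_val : IsClosedEmbedding (val : FreeProfiniteSemigroup A → _) := by
  refine ⟨⟨isInducing_val, fun x y h => FreeProfiniteSemigroup.ext h⟩, ?_⟩
  have : Set.range (val : FreeProfiniteSemigroup A → _) =
      ⋂ c, ⋂ d, ⋂ h : ∀ u v, c.con u v → d.con u v,
        {x | FiniteCongruence.map (MulHom.id _) c d h (x c) = x d} := by
    ext x
    simp only [Set.mem_range, Set.mem_iInter, Set.mem_ofPred_eq]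
    exact ⟨by rintro ⟨y, rfl⟩; exact y.compat, fun h => ⟨⟨x, h⟩, rfl⟩⟩
  rw [this]
  exact isClosed_iInter fun c => isClosed_iInter fun d => isClosed_iInter fun h =>
    isClosed_eq (continuous_of_discreteTopology.comp (continuous_apply c)) (continuous_apply d)

instance : T2Space (FreeProfiniteSemigroup A) := isClosedEmbedding_val.isEmbedding.t2Space

instance : TotallyDisconnectedSpace (FreeProfiniteSemigroup A) :=
  isClosedEmbedding_val.isEmbedding.isTotallyDisconnected_range.1
    (isTotallyDisconnected_of_totallyDisconnectedSpace _)

instance : CompactSpace (FreeProfiniteSemigroup A) := isClosedEmbedding_val.compactSpace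

instance : ContinuousMul (FreeProfiniteSemigroup A) where
  continuous_mul := isInducing_val.continuous_iff.2 <| continuous_pi fun c =>
    ((continuous_proj c).comp continuous_fst).mul ((continuous_proj c).comp continuous_snd)

/-- The canonical homomorphism from `A⁺` to the free profinite semigroup on `A`. -/
def ofWord : FreeSemigroup A →ₙ* FreeProfiniteSemigroup A where
  toFun w := ⟨fun c => c.cls w, fun _ _ _ => rfl⟩
  map_mul' _ _ := rfl

theorem proj_ofWord (c : FiniteCongruence A) (w : FreeSemigroup A) :
    proj c (ofWord w) = c.cls w := rfl

/-- Finitely many finite index congruences have a common refinement of finite index. -/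
theorem exists_common_refinement (s : Finset (FiniteCongruence A)) :
    ∃ c : FiniteCongruence A, ∀ d ∈ s, ∀ u v, c.con u v → d.con u v := by
  let F : FreeSemigroup A →ₙ* (∀ d : s, d.1.Quot) :=
    { toFun := fun w d => d.1.cls w
      map_mul' := fun u v => funext fun d => map_mul d.1.cls u v }
  refine ⟨⟨Con.ker F, ?_⟩, fun d hd u v h => ?_⟩
  · refine Finite.of_injective (β := ∀ d : s, d.1.Quot)
      (fun q => Con.liftOn q F fun _ _ h => h) ?_
    rintro ⟨u⟩ ⟨v⟩ h
    exact Quotient.sound' h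
  · exact d.cls_eq_cls.1 (congrFun h ⟨d, hd⟩)

theorem denseRange_ofWord : DenseRange (ofWord : FreeSemigroup A → FreeProfiniteSemigroup A) := by
  apply dense_iff_inter_open.mpr
  rintro U ⟨V, hV, rfl⟩ ⟨x, hx⟩
  obtain ⟨s, t, hst, hsub⟩ := isOpen_pi_iff.1 hV _ hx
  obtain ⟨c, hc⟩ := exists_common_refinement s
  obtain ⟨w, hw⟩ := c.cls_surjective (x.val c)
  refine ⟨ofWord w, hsub fun d hd => ?_, w, rfl⟩
  have h1 := x.compat c d (hc d hd)
  rw [← hw] at h1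
  have h2 : (ofWord w).val d = x.val d := h1
  exact h2 ▸ (hst d hd).2

/-- The continuous extension of a homomorphism `A⁺ → B⁺` to the free profinite semigroups. -/
def extend (φ : FreeSemigroup A →ₙ* FreeSemigroup B) :
    FreeProfiniteSemigroup A →ₙ* FreeProfiniteSemigroup B where
  toFun x :=
    { val := fun d =>
        FiniteCongruence.map φ (d.comap φ) d (fun _ _ h => h) (x.val (d.comap φ))
      compat := fun c d h => by
        rw [← x.compat (c.comap φ) (d.comap φ) fun u v huv => h _ _ huv]
        obtain ⟨u, hu⟩ := (c.comap φ).cls_surjective (x.val (c.comap φ))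
        rw [← hu]
        rfl }
  map_mul' x y := FreeProfiniteSemigroup.ext <| funext fun d =>
    map_mul (FiniteCongruence.map φ (d.comap φ) d fun _ _ h => h) _ _

theorem extend_ofWord (φ : FreeSemigroup A →ₙ* FreeSemigroup B) (w : FreeSemigroup A) :
    extend φ (ofWord w) = ofWord (φ w) := rfl

theorem continuous_extend (φ : FreeSemigroup A →ₙ* FreeSemigroup B) : Continuous (extend φ) :=
  isInducing_val.continuous_iff.2 <| continuous_pi fun d =>
    (continuous_of_discreteTopology (f := FiniteCongruence.map φ (d.comap φ) d
      fun _ _ h => h)).comp (continuous_proj (d.comap φ))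

/-- Continuous homomorphisms out of the free profinite semigroup are determined on letters. -/
theorem hom_ext {S : Type*} [Mul S] [TopologicalSpace S] [T2Space S]
    {f g : FreeProfiniteSemigroup A →ₙ* S} (hf : Continuous f) (hg : Continuous g)
    (h : ∀ a, f (ofWord (FreeSemigroup.of a)) = g (ofWord (FreeSemigroup.of a))) : f = g := by
  have : f.comp ofWord = g.comp ofWord := FreeSemigroup.hom_ext (funext h)
  exact DFunLike.coe_injective (denseRange_ofWord.equalizer hf hg (congrArg DFunLike.coe this))

/-- The `n`-th iterate of an endomorphism, as a homomorphism. -/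
def iterate (f : FreeProfiniteSemigroup A →ₙ* FreeProfiniteSemigroup A) (n : ℕ) :
    FreeProfiniteSemigroup A →ₙ* FreeProfiniteSemigroup A where
  toFun := f^[n]
  map_mul' x y := iterate_map_mul f n x y

theorem exists_omega [Finite A] (f : FreeProfiniteSemigroup A →ₙ* FreeProfiniteSemigroup A)
    (hf : Continuous f) : ∃ g : FreeProfiniteSemigroup A →ₙ* FreeProfiniteSemigroup A,
      Continuous g ∧ IsOmegaPower f g := by
  obtain ⟨g, hg, hlim⟩ := exists_isOmegaPower (fun c => proj (A := A) c) continuous_proj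
    (fun _ _ => ext_proj) f hf (fun c => by
      refine Set.Finite.of_finite_image (f := fun (h : FreeProfiniteSemigroup A → c.Quot) (a : A) =>
        h (ofWord (FreeSemigroup.of a))) (Set.toFinite _) ?_
      rintro _ ⟨m, rfl⟩ _ ⟨n, rfl⟩ h
      exact congrArg DFunLike.coe (hom_ext (f := (proj c).comp (iterate f m))
        (g := (proj c).comp (iterate f n)) ((continuous_proj c).comp (hf.iterate m))
        ((continuous_proj c).comp (hf.iterate n)) (congrFun h)))
  refine ⟨⟨g, fun x y => tendsto_nhds_unique (hlim (x * y)) ?_⟩, hg, hlim⟩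
  simpa only [iterate_map_mul] using (hlim x).mul (hlim y)

/-- The idempotent continuous endomorphism `φ^ω` of the free profinite semigroup on a finite
alphabet, for a substitution `φ`. -/
noncomputable def omega [Finite A] (φ : FreeSemigroup A →ₙ* FreeSemigroup A) :
    FreeProfiniteSemigroup A →ₙ* FreeProfiniteSemigroup A :=
  (exists_omega (extend φ) (continuous_extend φ)).choose

theorem continuous_omega [Finite A] (φ : FreeSemigroup A →ₙ* FreeSemigroup A) :
    Continuous (omega φ) :=
  (exists_omega (extend φ) (continuous_extend φ)).choose_spec.1

theorem isOmegaPower_omega [Finite A] (φ : FreeSemigroup A →ₙ* FreeSemigroup A) :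
    IsOmegaPower (extend φ) (omega φ) :=
  (exists_omega (extend φ) (continuous_extend φ)).choose_spec.2

end FreeProfiniteSemigroup

/-! ### Green's relations, subgroups of a semigroup -/

/-- Green's relation `R`: `x` and `y` generate the same right ideal. -/
def GreenR {S : Type*} [Mul S] (x y : S) : Prop :=
  (x = y ∨ ∃ s, x = y * s) ∧ (y = x ∨ ∃ s, y = x * s)

/-- Green's relation `L`: `x` and `y` generate the same left ideal. -/
def GreenL {S : Type*} [Mul S] (x y : S) : Prop :=
  (x = y ∨ ∃ s, x = s * y) ∧ (y = x ∨ ∃ s, y = s * x)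

/-- The subset `G` of a semigroup is a group under the multiplication of the semigroup. -/
structure IsSubgroup {S : Type*} [Semigroup S] (G : Set S) : Prop where
  /-- `G` is closed under multiplication. -/
  mul_mem : ∀ x ∈ G, ∀ y ∈ G, x * y ∈ G
  /-- `G` has a neutral element, and every element of `G` has an inverse in `G`. -/
  exists_one : ∃ e ∈ G, (∀ x ∈ G, e * x = x) ∧ ∀ x ∈ G, ∃ y ∈ G, y * x = e

/-- The group structure on a subset that is a group under the multiplication. -/
noncomputable abbrev IsSubgroup.group {S : Type*} [Semigroup S] {G : Set S} (h : IsSubgroup G) :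
    Group G :=
  letI : Mul G := ⟨fun x y => ⟨x.1 * y.1, h.mul_mem _ x.2 _ y.2⟩⟩
  letI : One G := ⟨⟨h.exists_one.choose, h.exists_one.choose_spec.1⟩⟩
  letI : Inv G := ⟨fun x => ⟨(h.exists_one.choose_spec.2.2 _ x.2).choose,
    (h.exists_one.choose_spec.2.2 _ x.2).choose_spec.1⟩⟩
  Group.ofLeftAxioms (fun _ _ _ => Subtype.ext (mul_assoc _ _ _))
    (fun x => Subtype.ext (h.exists_one.choose_spec.2.1 _ x.2))
    (fun x => Subtype.ext (h.exists_one.choose_spec.2.2 _ x.2).choose_spec.2)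

/-- A maximal subgroup of a semigroup. -/
structure IsMaximalSubgroup {S : Type*} [Semigroup S] (G : Set S) : Prop where
  /-- It is a subgroup. -/
  isSubgroup : IsSubgroup G
  /-- It is contained in no other subgroup. -/
  maximal : ∀ H : Set S, IsSubgroup H → G ⊆ H → H = G

/-! ### Substitutions -/

section Substitution

variable {A : Type*}

/-- The language `L(X_φ)` of the subshift of a substitution `φ`: the nonempty words that are
factors of `φ^k(c)`, `c` a letter, for arbitrarily large `k`. -/
def substitutionLanguage (φ : FreeSemigroup A →ₙ* FreeSemigroup A) : Set (FreeSemigroup A) :=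
  {w | ∀ N : ℕ, ∃ k ≥ N, ∃ c : A,
    (w.head :: w.tail) <:+:
      ((φ^[k] (FreeSemigroup.of c)).head :: (φ^[k] (FreeSemigroup.of c)).tail)}

/-- The set `J(φ)` of the elements of the closure of `L(X_φ)` in the free profinite semigroup that
are not in `L(X_φ)`. -/
def substitutionJClass (φ : FreeSemigroup A →ₙ* FreeSemigroup A) :
    Set (FreeProfiniteSemigroup A) :=
  closure (FreeProfiniteSemigroup.ofWord '' substitutionLanguage φ) \
    FreeProfiniteSemigroup.ofWord '' substitutionLanguage φ

/-- The Schützenberger group `G(φ)` of a substitution for a connection `ba`: the intersection of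
the `R`-class of `φ^ω(a)` and the `L`-class of `φ^ω(b)`. -/
def schutzenbergerGroup [Finite A] (φ : FreeSemigroup A →ₙ* FreeSemigroup A) (b a : A) :
    Set (FreeProfiniteSemigroup A) :=
  {x | GreenR x (FreeProfiniteSemigroup.omega φ
        (FreeProfiniteSemigroup.ofWord (FreeSemigroup.of a))) ∧
    GreenL x (FreeProfiniteSemigroup.omega φ
        (FreeProfiniteSemigroup.ofWord (FreeSemigroup.of b)))}

end Substitution

/-! ### Free profinite groups and presentations -/

/-- The free profinite group on a (finite) set `X`, as the profinite completion of the free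
group on `X`. -/
abbrev FreeProfiniteGroup (X : Type) : ProfiniteGrp.{0} :=
  ProfiniteGrp.ProfiniteCompletion.completion (GrpCat.of (FreeGroup X))

namespace FreeProfiniteGroup

variable {X : Type}

/-- The generators of the free profinite group. -/
def of (x : X) : FreeProfiniteGroup X :=
  ProfiniteGrp.ProfiniteCompletion.etaFn (GrpCat.of (FreeGroup X)) (FreeGroup.of x)

/-- The continuous homomorphism with given values on the generators. -/
noncomputable def lift {P : ProfiniteGrp.{0}} (f : X → P) : FreeProfiniteGroup X →ₜ* P :=
  (ProfiniteGrp.ProfiniteCompletion.lift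
    (GrpCat.ofHom (FreeGroup.lift f) : GrpCat.of (FreeGroup X) ⟶ GrpCat.of P)).hom

theorem lift_of {P : ProfiniteGrp.{0}} (f : X → P) (x : X) : lift f (of x) = f x := by
  have h := ProfiniteGrp.ProfiniteCompletion.lift_eta
    (GrpCat.ofHom (FreeGroup.lift f) : GrpCat.of (FreeGroup X) ⟶ GrpCat.of P)
  have h2 := CategoryTheory.ConcreteCategory.congr_hom h (FreeGroup.of x)
  exact h2.trans (FreeGroup.lift_apply_of)

/-- Continuous homomorphisms out of the free profinite group are determined on generators. -/
theorem hom_ext {T : Type*} [Monoid T] [TopologicalSpace T] [T2Space T]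
    {f g : FreeProfiniteGroup X →* T} (hf : Continuous f) (hg : Continuous g)
    (h : ∀ x, f (of x) = g (of x)) : f = g := by
  let e : FreeGroup X →* FreeProfiniteGroup X :=
    (ProfiniteGrp.ProfiniteCompletion.eta (GrpCat.of (FreeGroup X))).hom
  have h1 : f.comp e = g.comp e := FreeGroup.ext_hom _ _ h
  exact DFunLike.coe_injective (ProfiniteGrp.ProfiniteCompletion.denseRange _ |>.equalizer hf hg
    (congrArg DFunLike.coe h1))

/-- The `n`-th iterate of an endomorphism, as a homomorphism. -/
def iterate (f : FreeProfiniteGroup X →ₜ* FreeProfiniteGroup X) (n : ℕ) :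
    FreeProfiniteGroup X →* FreeProfiniteGroup X where
  toFun := f^[n]
  map_one' := iterate_map_one f n
  map_mul' x y := iterate_map_mul f n x y

/-- The projection onto the quotient by an open normal subgroup. -/
def proj (U : OpenNormalSubgroup (FreeProfiniteGroup X)) :
    FreeProfiniteGroup X →* FreeProfiniteGroup X ⧸ U.toSubgroup :=
  QuotientGroup.mk' U.toSubgroup

theorem exists_omega [Finite X] (f : FreeProfiniteGroup X →ₜ* FreeProfiniteGroup X) :
    ∃ g : FreeProfiniteGroup X →ₜ* FreeProfiniteGroup X, IsOmegaPower f g := by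
  have hfc : Continuous f := f.continuous_toFun
  obtain ⟨g, hg, hlim⟩ := exists_isOmegaPower (fun U => proj (X := X) U)
    (fun U => continuous_quotient_mk') (fun x y h => by
      by_contra hne
      have hxy : x⁻¹ * y ≠ 1 := fun h => hne (inv_mul_eq_one.1 h)
      obtain ⟨U, hU⟩ := ProfiniteGrp.exist_openNormalSubgroup_sub_open_nhds_of_one
        (isOpen_compl_singleton (x := x⁻¹ * y)) (Ne.symm hxy)
      exact hU (QuotientGroup.eq.1 (h U)) rfl) f hfc (fun U => by
      refine Set.Finite.of_finite_image
        (f := fun (h : FreeProfiniteGroup X → FreeProfiniteGroup X ⧸ U.toSubgroup) (x : X) =>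
          h (of x)) (Set.toFinite _) ?_
      rintro _ ⟨m, rfl⟩ _ ⟨n, rfl⟩ h
      exact congrArg DFunLike.coe (hom_ext (f := (proj U).comp (iterate f m))
        (g := (proj U).comp (iterate f n)) (continuous_quotient_mk'.comp (hfc.iterate m))
        (continuous_quotient_mk'.comp (hfc.iterate n)) (congrFun h)))
  refine ⟨⟨MonoidHom.mk' g fun x y => tendsto_nhds_unique (hlim (x * y)) ?_, hg⟩, hlim⟩
  simpa only [iterate_map_mul] using (hlim x).mul (hlim y)

/-- The idempotent continuous endomorphism `Φ^ω`, for a continuous endomorphism `Φ` of the free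
profinite group on a finite set. -/
noncomputable def omega [Finite X] (Φ : FreeProfiniteGroup X →ₜ* FreeProfiniteGroup X) :
    FreeProfiniteGroup X →ₜ* FreeProfiniteGroup X :=
  (exists_omega Φ).choose

theorem isOmegaPower_omega [Finite X] (Φ : FreeProfiniteGroup X →ₜ* FreeProfiniteGroup X) :
    IsOmegaPower Φ (omega Φ) :=
  (exists_omega Φ).choose_spec

end FreeProfiniteGroup

section Presentation

variable {X : Type} {T : Type*} [Group T] [TopologicalSpace T]

/-- `Φ` is a lifting of the endomorphism `φ` of `T` via `π`. -/
def IsLifting (φ : T →ₜ* T) (π : FreeProfiniteGroup X →ₜ* T)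
    (Φ : FreeProfiniteGroup X →ₜ* FreeProfiniteGroup X) : Prop :=
  ∀ u, π (Φ u) = φ (π u)

/-- The set `L_φ(π)` of the liftings `Φ` of `φ` via `π` such that `Ker π ⊆ Ker Φ^ω`. -/
def kernelLiftings [Finite X] (φ : T →ₜ* T) (π : FreeProfiniteGroup X →ₜ* T) :
    Set (FreeProfiniteGroup X →ₜ* FreeProfiniteGroup X) :=
  {Φ | IsLifting φ π Φ ∧ ∀ u, π u = 1 → FreeProfiniteGroup.omega Φ u = 1}

/-- The generators `π(x)`, `x ∈ X`, and the relators `r ∈ R` present the profinite group `T`: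
the continuous homomorphism `π` is onto, and its kernel is the topological closure of the normal
closure of `R`. -/
def IsProfinitePresentation (π : FreeProfiniteGroup X →ₜ* T) (R : Set (FreeProfiniteGroup X)) :
    Prop :=
  Function.Surjective π ∧
    π.toMonoidHom.ker = (Subgroup.normalClosure R).topologicalClosure

end Presentation

/-! ### The Prouhet-Thue-Morse substitution -/

/-- The two-letter alphabet. -/
inductive Letter where
  | a : Letter
  | b : Letter

instance : Finite Letter :=
  Finite.of_surjective (fun t : Bool => if t then Letter.a else Letter.b) fun
    | .a => ⟨true, rfl⟩
    | .b => ⟨false, rfl⟩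

/-- The Prouhet-Thue-Morse substitution `a ↦ ab`, `b ↦ ba`. -/
def thueMorse : FreeSemigroup Letter →ₙ* FreeSemigroup Letter :=
  FreeSemigroup.lift fun
    | .a => ⟨.a, [.b]⟩
    | .b => ⟨.b, [.a]⟩

/-- The group `G(τ)` of the Prouhet-Thue-Morse substitution `τ`, for the connection `aa`. -/
def thueMorseGroup : Set (FreeProfiniteSemigroup Letter) :=
  schutzenbergerGroup thueMorse .a .a

/-- The three generators. -/
inductive Gen where
  | α : Gen
  | β : Gen
  | γ : Gen

instance : Finite Gen :=
  Finite.of_surjective (fun i : Fin 3 => if i = 0 then Gen.α else if i = 1 then Gen.β else Gen.γ)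
    fun
    | .α => ⟨0, rfl⟩
    | .β => ⟨1, rfl⟩
    | .γ => ⟨2, rfl⟩

/-- The words `abba`, `ababba`, `abbaba`. -/
def genWord : Gen → FreeSemigroup Letter
  | .α => ⟨.a, [.b, .b, .a]⟩
  | .β => ⟨.a, [.b, .a, .b, .b, .a]⟩
  | .γ => ⟨.a, [.b, .b, .a, .b, .a]⟩

/-- The images `γαβ`, `γβα⁻¹γαβ`, `γαβα⁻¹γβ` of the generators `α`, `β`, `γ`. -/
def psiValue : Gen → FreeProfiniteGroup Gen :=
  let α := FreeProfiniteGroup.of Gen.α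
  let β := FreeProfiniteGroup.of Gen.β
  let γ := FreeProfiniteGroup.of Gen.γ
  fun
    | .α => γ * α * β
    | .β => γ * β * α⁻¹ * γ * α * β
    | .γ => γ * α * β * α⁻¹ * γ * β

/-- The continuous endomorphism `Ψ` of the free profinite group on `α`, `β`, `γ`. -/
noncomputable def bigPsi : FreeProfiniteGroup Gen →ₜ* FreeProfiniteGroup Gen :=
  FreeProfiniteGroup.lift psiValue

/-! ### Periods of iterates -/

/-! Write g = τ^ω(a). Group: aa is a factor of τ^4(a), so g lies in the ideal generated by g² =
τ^ω(aa). Stability of compact semigroups then makes g both R- and L-equivalent to g², and the class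
of g is the group of units at an idempotent (`exists_greenClass_eq_unitsAt`).

Generators: cutting between the two letters of each aa splits words of the language into the return
words abba, ababba, abbaba and δ = ababbaba. Every element of G(τ) begins and ends with long words
τ^n(a), n even, and is a prefix of g. It is therefore approximated by factors of τ^k(a) that begin
and end with such a word. Since τ is synchronizing, these factors are τ^n-images of products of
return words (`exists_proj_eq_proj_returnCode`). Hence G(τ) is the closure of the elements τ^ω(v), v
a product of return words. As δ = βα⁻¹γ holds in the free group on a and b, three generators suffice
and π is onto. It also follows that τ^ω fixes G(τ) pointwise, so the powers ψ^(n!) tend to the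
identity; this makes ψ bijective and gives π ∘ Ψ^ω = π.

Kernel: on products of return words τ² acts as a substitution, and Ψ is that substitution with δ
read as βα⁻¹γ. A finite automaton decodes products of return words into any finite group quotient of
F, provided that δ goes to the value of βα⁻¹γ (`exists_recognizing`). So the image of a decoded
product in a finite quotient of F depends only on the class of its spelling in a finite quotient of
A⁺. Applied to large iterates, this shows that Ψ^ω(u) depends only on π(u), which is Ker π ⊆ Ker
Ψ^ω.

Presentation: modulo the closed normal subgroup generated by the relators, Ψ^ω is the identity,
while it kills Ker π; so Ker π lies in that subgroup. The converse inclusion is π ∘ Ψ^ω = π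
(`isProfinitePresentation_of_omega`). -/

/-- If the maps `p ∘ f^[n]` are finite in number, then `p ∘ f^ω = p ∘ f^[m]` for all positive
multiples `m` of some positive integer. -/
theorem IsOmegaPower.exists_period {S Q : Type*} [TopologicalSpace S] [TopologicalSpace Q]
    [T2Space Q] {f g : S → S} (h : IsOmegaPower f g) {p : S → Q} (hp : Continuous p)
    (hfin : (Set.range fun n : ℕ => p ∘ f^[n]).Finite) :
    ∃ N : ℕ, 0 < N ∧ ∀ m, 0 < m → N ∣ m → ∀ x, p (g x) = p (f^[m] x) := by
  have hni : ¬ Function.Injective (fun n : ℕ => p ∘ f^[n]) := fun h =>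
    Set.infinite_range_of_injective h hfin
  obtain ⟨i, d, hd, hid⟩ : ∃ i d, 0 < d ∧ p ∘ f^[i + d] = p ∘ f^[i] := by
    simp only [Function.Injective, not_forall] at hni
    obtain ⟨i, j, h, hij⟩ := hni
    rcases lt_or_gt_of_ne hij with hlt | hlt
    · exact ⟨i, j - i, by omega, by rw [Nat.add_sub_cancel' hlt.le]; exact h.symm⟩
    · exact ⟨j, i - j, by omega, by rw [Nat.add_sub_cancel' hlt.le]; exact h⟩
  have h1 : ∀ n, i ≤ n → p ∘ f^[n + d] = p ∘ f^[n] := by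
    intro n hn
    obtain ⟨k, rfl⟩ := Nat.exists_eq_add_of_le hn
    have e : i + k + d = (i + d) + k := by omega
    rw [e, Function.iterate_add f (i + d) k, Function.iterate_add f i k, ← Function.comp_assoc,
      hid, Function.comp_assoc]
  have h2 : ∀ m n, i ≤ n → p ∘ f^[n + d * m] = p ∘ f^[n] := by
    intro m n hn
    induction m with
    | zero => rfl
    | succ m ih => rw [Nat.mul_succ, ← Nat.add_assoc, h1 _ (by omega), ih]
  -- The integer d(i + 1) is a multiple of the period that also exceeds the preperiod i.
  have hi : i ≤ d * (i + 1) := by nlinarith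
  have h3 : ∀ m, 0 < m → d * (i + 1) ∣ m → p ∘ f^[m] = p ∘ f^[d * (i + 1)] := by
    rintro _ hm ⟨j, rfl⟩
    obtain ⟨k, rfl⟩ : ∃ k, j = k + 1 :=
      ⟨j - 1, by have := Nat.pos_of_mul_pos_left hm; omega⟩
    rw [show d * (i + 1) * (k + 1) = d * (i + 1) + d * ((i + 1) * k) by ring, h2 _ _ hi]
  have hN : 0 < d * (i + 1) := by positivity
  refine ⟨d * (i + 1), hN, fun m hm hdvd x => ?_⟩
  refine tendsto_nhds_unique ((hp.tendsto _).comp (h x)) (tendsto_const_nhds.congr' ?_)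
  filter_upwards [eventually_ge_atTop (d * (i + 1))] with n hn
  exact congrFun ((h3 m hm hdvd).trans
    (h3 _ n.factorial_pos (Nat.dvd_factorial hN hn)).symm) x

/-! ### Compact semigroups -/

theorem isClosed_setOf_exists_eq {S : Type*} [TopologicalSpace S] [CompactSpace S] [T2Space S]
    {f g : S → S → S} (hf : Continuous f.uncurry)
    (hg : Continuous g.uncurry) : IsClosed {x : S | ∃ y, f x y = g x y} := by
  have := isClosedMap_fst_of_compactSpace (X := S) (Y := S) _ (isClosed_eq hf hg)
  convert this using 1
  ext p
  simp [Function.uncurry]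

section CompactSemigroup

variable {S : Type*} [Semigroup S] [TopologicalSpace S] [CompactSpace S] [T2Space S]
  [ContinuousMul S]

theorem isClosed_range_mul_left (u : S) : IsClosed {p : S | ∃ x, p = u * x} := by
  have := (isCompact_range (f := fun x => u * x) (by fun_prop)).isClosed
  convert this using 1
  ext p
  simp [eq_comm]

theorem isClosed_range_mul_right (u : S) : IsClosed {p : S | ∃ x, p = x * u} := by
  have := (isCompact_range (f := fun x => x * u) (by fun_prop)).isClosed
  convert this using 1
  ext p
  simp [eq_comm]

theorem isClosed_setOf_factor (u : S) : IsClosed {p : S | ∃ x y, p = x * u * y} := by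
  have := (isCompact_range (f := fun x : S × S => x.1 * u * x.2) (by fun_prop)).isClosed
  convert this using 1
  ext p
  simp [eq_comm]

/-- Stability of compact semigroups. -/
theorem exists_eq_mul_of_factor {x y p q s : S} (hy : y = p * x * q) (hx : x = y * s) :
    ∃ r, y = x * r := by
  -- An idempotent f of this closed subsemigroup satisfies y = uyf, hence y = yf, and yf lies in
  -- ysqS = xqS.
  let K : Set S := {v | (∃ u, u * y * v = y) ∧ ∃ r, v = s * q * r}
  have hclosed : IsClosed K :=
    (isClosed_setOf_exists_eq (f := fun v u => u * y * v) (g := fun _ _ => y) (by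
      unfold Function.uncurry; fun_prop) (by unfold Function.uncurry; fun_prop)).inter
      (isClosed_range_mul_left _)
  have hv0 : p * y * (s * q) = y := by
    conv_rhs => rw [hy, hx]
    simp only [mul_assoc]
  obtain ⟨f, ⟨⟨u, hu⟩, r, hr⟩, hf⟩ := exists_idempotent_in_compact_subsemigroup
    (M := S) (fun r => continuous_id.mul continuous_const) K
    -- Without an identity, sq itself need not have the form sqr; its square does.
    ⟨s * q * (s * q), ⟨p * p, by
      calc p * p * y * (s * q * (s * q)) = p * (p * y * (s * q)) * (s * q) := by
            simp only [mul_assoc]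
        _ = y := by rw [hv0, hv0]⟩, _, rfl⟩ hclosed.isCompact (by
      rintro v ⟨⟨u, hu⟩, r, hr⟩ v' ⟨⟨u', hu'⟩, r', hr'⟩
      refine ⟨⟨u' * u, ?_⟩, r * v', by rw [hr]; simp only [mul_assoc]⟩
      calc u' * u * y * (v * v') = u' * (u * y * v) * v' := by simp only [mul_assoc]
        _ = y := by rw [hu, hu'])
  refine ⟨q * r, ?_⟩
  calc y = y * f := by
        conv_lhs => rw [← hu, ← hf]
        conv_rhs => rw [← hu]
        simp only [mul_assoc]
    _ = x * (q * r) := by rw [hr, hx]; simp only [mul_assoc]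

theorem exists_eq_mul_of_factor' {x y p q s : S} (hy : y = p * x * q) (hx : x = s * y) :
    ∃ r, y = r * x := by
  obtain ⟨r, hr⟩ := exists_eq_mul_of_factor (S := Sᵐᵒᵖ) (x := .op x) (y := .op y) (p := .op q)
    (q := .op p) (s := .op s) (by rw [hy]; simp [mul_assoc]) (by rw [hx]; simp)
  exact ⟨r.unop, by simpa using congrArg MulOpposite.unop hr⟩

end CompactSemigroup

/-! ### Green's relations and maximal subgroups -/

theorem GreenR.trans {S : Type*} [Semigroup S] {x y z : S} (h : GreenR x y) (h' : GreenR y z) :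
    GreenR x z := by
  have key : ∀ {x y z : S}, (x = y ∨ ∃ s, x = y * s) → (y = z ∨ ∃ s, y = z * s) →
      (x = z ∨ ∃ s, x = z * s) := by
    rintro x y z (rfl | ⟨s, rfl⟩) (rfl | ⟨t, rfl⟩)
    exacts [.inl rfl, .inr ⟨t, rfl⟩, .inr ⟨s, rfl⟩, .inr ⟨t * s, mul_assoc _ _ _⟩]
  exact ⟨key h.1 h'.1, key h'.2 h.2⟩

theorem GreenL.trans {S : Type*} [Semigroup S] {x y z : S} (h : GreenL x y) (h' : GreenL y z) :
    GreenL x z := by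
  have key : ∀ {x y z : S}, (x = y ∨ ∃ s, x = s * y) → (y = z ∨ ∃ s, y = s * z) →
      (x = z ∨ ∃ s, x = s * z) := by
    rintro x y z (rfl | ⟨s, rfl⟩) (rfl | ⟨t, rfl⟩)
    exacts [.inl rfl, .inr ⟨t, rfl⟩, .inr ⟨s, rfl⟩, .inr ⟨s * t, (mul_assoc _ _ _).symm⟩]
  exact ⟨key h.1 h'.1, key h'.2 h.2⟩

theorem GreenR.map {S T : Type*} [Mul S] [Mul T] (f : S →ₙ* T) {x y : S} (h : GreenR x y) :
    GreenR (f x) (f y) :=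
  ⟨h.1.imp (congrArg f) fun ⟨s, hs⟩ => ⟨f s, by rw [hs, map_mul]⟩,
    h.2.imp (congrArg f) fun ⟨s, hs⟩ => ⟨f s, by rw [hs, map_mul]⟩⟩

theorem GreenL.map {S T : Type*} [Mul S] [Mul T] (f : S →ₙ* T) {x y : S} (h : GreenL x y) :
    GreenL (f x) (f y) :=
  ⟨h.1.imp (congrArg f) fun ⟨s, hs⟩ => ⟨f s, by rw [hs, map_mul]⟩,
    h.2.imp (congrArg f) fun ⟨s, hs⟩ => ⟨f s, by rw [hs, map_mul]⟩⟩

section MaximalSubgroup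

variable {S : Type*} [Semigroup S]

/-- The elements that are invertible with respect to `e`. -/
def unitsAt (e : S) : Set S :=
  {x | e * x = x ∧ x * e = x ∧ (∃ s, x * s = e) ∧ ∃ s, s * x = e}

theorem isMaximalSubgroup_unitsAt {e : S} (he : e * e = e) : IsMaximalSubgroup (unitsAt e) := by
  have hmem : e ∈ unitsAt e := ⟨he, he, ⟨e, he⟩, e, he⟩
  refine ⟨⟨?_, e, hmem, fun x hx => hx.1, ?_⟩, fun H hH hsub => ?_⟩
  · rintro x ⟨h1, h2, ⟨s, h3⟩, r, h4⟩ y ⟨k1, k2, ⟨t, k3⟩, q, k4⟩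
    refine ⟨by rw [← mul_assoc, h1], by rw [mul_assoc, k2], ⟨t * s, ?_⟩, q * r, ?_⟩
    · rw [mul_assoc, ← mul_assoc y, k3, ← mul_assoc, h2, h3]
    · rw [mul_assoc, ← mul_assoc r, h4, k1, k4]
  · rintro x ⟨h1, h2, ⟨s, h3⟩, r, h4⟩
    have hxy : x * (e * s * e) = e := by rw [← mul_assoc, ← mul_assoc, h2, h3, he]
    have hyx : e * s * e * x = e := by
      have : r * (x * (e * s * e)) = r * e := by rw [hxy]
      have hy : e * s * e = r * e := by
        rw [← this, ← mul_assoc, h4, ← mul_assoc, ← mul_assoc, he]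
      rw [hy, mul_assoc, h1, h4]
    exact ⟨e * s * e, ⟨by rw [← mul_assoc, ← mul_assoc, he], by rw [mul_assoc, he], ⟨x, hyx⟩,
      x, hxy⟩, hyx⟩
  · obtain ⟨f, hf, hone, hinv⟩ := hH.exists_one
    have hef : e = f := by
      obtain ⟨y, -, hy⟩ := hinv e (hsub hmem)
      calc e = f * e := (hone e (hsub hmem)).symm
        _ = f := by rw [← hy, mul_assoc, he]
    subst hef
    refine subset_antisymm (fun x hx => ?_) hsub
    obtain ⟨y, hyH, hy⟩ := hinv x hx
    obtain ⟨z, -, hz⟩ := hinv y hyH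
    have hxy : x * y = e := by
      calc x * y = e * (x * y) := (hone _ (hH.mul_mem _ hx _ hyH)).symm
        _ = z * y * (x * y) := by rw [hz]
        _ = z * ((y * x) * y) := by simp only [mul_assoc]
        _ = e := by rw [hy, hone y hyH, hz]
    exact ⟨hone x hx, by rw [← hy, ← mul_assoc, hxy, hone x hx], ⟨y, hxy⟩, y, hy⟩

/-- The `H`-class of an element that is `R`- and `L`-equivalent to its square. -/
theorem exists_greenClass_eq_unitsAt {g t t' : S} (h : g = g * g * t) (h' : g = t' * (g * g)) :
    ∃ e : S, e * e = e ∧ {x | GreenR x g ∧ GreenL x g} = unitsAt e := by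
  have hte : g * t = t' * g := by
    calc g * t = t' * (g * g) * t := by rw [← h']
      _ = t' * (g * g * t) := by simp only [mul_assoc]
      _ = t' * g := by rw [← h]
  have heg : g * t * g = g := by rw [hte, mul_assoc, ← h']
  have hge : g * (g * t) = g := by rw [← mul_assoc, ← h]
  refine ⟨g * t, by rw [← mul_assoc, heg], Set.ext fun x => ⟨?_, ?_⟩⟩
  · rintro ⟨⟨h1, h2⟩, h3, h4⟩
    refine ⟨?_, ?_, ?_, ?_⟩
    · rcases h1 with rfl | ⟨s, rfl⟩
      exacts [heg, by rw [← mul_assoc, heg]]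
    · rcases h3 with rfl | ⟨s, rfl⟩
      exacts [hge, by rw [mul_assoc, hge]]
    · rcases h2 with rfl | ⟨s, rfl⟩
      exacts [⟨t, rfl⟩, ⟨s * t, (mul_assoc _ _ _).symm⟩]
    · rw [hte]
      rcases h4 with rfl | ⟨s, rfl⟩
      exacts [⟨t', rfl⟩, ⟨t' * s, mul_assoc _ _ _⟩]
  · rintro ⟨h1, h2, ⟨s, h3⟩, r, h4⟩
    refine ⟨⟨.inr ⟨t * x, ?_⟩, .inr ⟨s * g, ?_⟩⟩, .inr ⟨x * t', ?_⟩, .inr ⟨g * r, ?_⟩⟩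
    · rw [← mul_assoc, h1]
    · rw [← mul_assoc, h3, heg]
    · rw [mul_assoc, ← hte, h2]
    · rw [mul_assoc, h4, hge]

theorem isClosed_unitsAt [TopologicalSpace S] [CompactSpace S] [T2Space S] [ContinuousMul S]
    (e : S) : IsClosed (unitsAt e) := by
  refine (isClosed_eq (by fun_prop) (by fun_prop)).inter
    ((isClosed_eq (by fun_prop) (by fun_prop)).inter (IsClosed.inter ?_ ?_))
  · exact isClosed_setOf_exists_eq (f := fun x y => x * y) (g := fun _ _ => e)
      (by unfold Function.uncurry; fun_prop) (by unfold Function.uncurry; fun_prop)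
  · exact isClosed_setOf_exists_eq (f := fun x y => y * x) (g := fun _ _ => e)
      (by unfold Function.uncurry; fun_prop) (by unfold Function.uncurry; fun_prop)

end MaximalSubgroup

/-- A compact Hausdorff group with continuous multiplication is a topological group. -/
theorem isTopologicalGroup_of_compactSpace (G : Type*) [Group G] [TopologicalSpace G]
    [CompactSpace G] [T2Space G] [ContinuousMul G] : IsTopologicalGroup G where
  continuous_inv := by
    -- The shear (x, y) ↦ (x, xy) is a continuous bijection of a compact Hausdorff space, hence a
    -- homeomorphism; its inverse sends (x, 1) to (x, x⁻¹).
    let f : G × G ≃ G × G := (Equiv.refl G).prodShear Equiv.mulLeft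
    have hf : Continuous f := by
      change Continuous fun x : G × G => (x.1, x.1 * x.2)
      fun_prop
    have h := (hf.homeoOfEquivCompactToT2.symm.continuous.comp
      (continuous_id.prodMk (continuous_const (y := (1 : G))))).snd
    convert h using 1
    ext x
    change x⁻¹ = x⁻¹ * 1
    rw [mul_one]

/-! ### Words as lists -/

namespace FreeSemigroup

variable {A : Type*}

/-- The list of letters of a word. -/
def toList (w : FreeSemigroup A) : List A := w.head :: w.tail

theorem toList_mul (u v : FreeSemigroup A) : (u * v).toList = u.toList ++ v.toList := rfl

theorem toList_injective : Function.Injective (toList : FreeSemigroup A → List A) := by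
  rintro ⟨x, l⟩ ⟨y, m⟩ h
  simpa [toList] using h

theorem exists_toList_eq {l : List A} (h : l ≠ []) : ∃ w : FreeSemigroup A, w.toList = l := by
  cases l with
  | nil => exact absurd rfl h
  | cons x l => exact ⟨⟨x, l⟩, rfl⟩

theorem length_toList (w : FreeSemigroup A) : w.toList.length = w.length := rfl

theorem length_pos (w : FreeSemigroup A) : 0 < w.length := Nat.succ_pos _

/-- Equidivisibility of free semigroups. -/
theorem mul_eq_mul_cases {u v s t : FreeSemigroup A} (h : u * v = s * t) :
    (u = s ∧ v = t) ∨ (∃ r, s = u * r ∧ v = r * t) ∨ ∃ r, u = s * r ∧ t = r * v := by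
  have h' : u.toList ++ v.toList = s.toList ++ t.toList := by rw [← toList_mul, h, toList_mul]
  have key : ∀ {u v s t : FreeSemigroup A} (l : List A), s.toList = u.toList ++ l →
      v.toList = l ++ t.toList → (u = s ∧ v = t) ∨ ∃ r, s = u * r ∧ v = r * t := by
    intro u v s t l h1 h2
    by_cases hl : l = []
    · subst hl
      exact .inl ⟨toList_injective (by simpa using h1.symm), toList_injective (by simpa using h2)⟩
    · obtain ⟨r, rfl⟩ := exists_toList_eq hl
      exact .inr ⟨r, toList_injective h1, toList_injective h2⟩
  rcases List.append_eq_append_iff.1 h' with ⟨l, h1, h2⟩ | ⟨l, h1, h2⟩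
  · rcases key l h1 h2 with h | h
    exacts [.inl h, .inr (.inl h)]
  · rcases key l h1 h2 with h | h
    exacts [.inl ⟨h.1.symm, h.2.symm⟩, .inr (.inr h)]

end FreeSemigroup

/-! ### Congruences of finite index -/

namespace FiniteCongruence

variable {A : Type*}

/-- The kernel of a homomorphism into a finite semigroup. -/
def ker {T : Type*} [Semigroup T] [Finite T] (f : FreeSemigroup A →ₙ* T) : FiniteCongruence A where
  con := Con.ker f
  finite := by
    refine Finite.of_injective (β := T) (fun q => Con.liftOn q f fun _ _ h => h) ?_
    rintro ⟨u⟩ ⟨v⟩ h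
    exact Quotient.sound' h

/-- The pairs of classes of the factorizations of a word into two factors. -/
def splittings (c : FiniteCongruence A) (w : FreeSemigroup A) : Set (c.Quot × c.Quot) :=
  {p | ∃ u v, w = u * v ∧ p = (c.cls u, c.cls v)}

/-- By equidivisibility a cut of uv falls between u and v, inside v or inside u. An inner cut is
transported by equality of splittings, the untouched factor by equality of classes. This makes
`splitRefinement` a congruence. -/
theorem splittings_mul_subset (c : FiniteCongruence A) {u u' v v' : FreeSemigroup A}
    (hu : c.cls u = c.cls u') (hu' : c.splittings u = c.splittings u')
    (hv : c.cls v = c.cls v') (hv' : c.splittings v = c.splittings v') :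
    c.splittings (u * v) ⊆ c.splittings (u' * v') := by
  rintro _ ⟨s, t, h, rfl⟩
  rcases FreeSemigroup.mul_eq_mul_cases h with ⟨rfl, rfl⟩ | ⟨r, rfl, rfl⟩ | ⟨r, rfl, rfl⟩
  · exact ⟨u', v', rfl, by rw [hu, hv]⟩
  · obtain ⟨r', t', rfl, he⟩ : (c.cls r, c.cls t) ∈ c.splittings v' := hv' ▸ ⟨r, t, rfl, rfl⟩
    obtain ⟨h1, h2⟩ := Prod.ext_iff.1 he
    exact ⟨u' * r', t', (mul_assoc _ _ _).symm, by
      simp only at h1 h2; rw [map_mul, map_mul, hu, h1, h2]⟩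
  · obtain ⟨s', r', rfl, he⟩ : (c.cls s, c.cls r) ∈ c.splittings u' := hu' ▸ ⟨s, r, rfl, rfl⟩
    obtain ⟨h1, h2⟩ := Prod.ext_iff.1 he
    exact ⟨s', r' * v', mul_assoc _ _ _, by
      simp only at h1 h2; rw [map_mul, map_mul, hv, h1, h2]⟩

/-- The refinement of a congruence that takes the factorizations of words into account. -/
def splitRefinement (c : FiniteCongruence A) : FiniteCongruence A where
  con :=
    { r := fun u v => c.cls u = c.cls v ∧ c.splittings u = c.splittings v
      iseqv := ⟨fun _ => ⟨rfl, rfl⟩, fun h => ⟨h.1.symm, h.2.symm⟩,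
        fun h h' => ⟨h.1.trans h'.1, h.2.trans h'.2⟩⟩
      mul' := fun h h' => ⟨by rw [map_mul, map_mul, h.1, h'.1], subset_antisymm
        (c.splittings_mul_subset h.1 h.2 h'.1 h'.2)
        (c.splittings_mul_subset h.1.symm h.2.symm h'.1.symm h'.2.symm)⟩ }
  finite := by
    refine Finite.of_injective (β := c.Quot × Set (c.Quot × c.Quot))
      (fun q => Quotient.liftOn' q (fun u => (c.cls u, c.splittings u))
        fun _ _ h => Prod.ext h.1 h.2) ?_
    rintro ⟨u⟩ ⟨v⟩ h
    exact Quotient.sound' (Prod.ext_iff.1 h)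

/-- The congruence that identifies all words of length greater than `l`, and no others. -/
def truncation [Finite A] (l : ℕ) : FiniteCongruence A where
  con :=
    { r := fun u v => u = v ∨ (l < u.length ∧ l < v.length)
      iseqv := ⟨fun _ => .inl rfl, fun h => h.imp Eq.symm And.symm, by
        rintro u v w (rfl | h) (rfl | h')
        exacts [.inl rfl, .inr h', .inr h, .inr ⟨h.1, h'.2⟩]⟩
      mul' := by
        rintro u v w x (rfl | h) (rfl | h')
        · exact .inl rfl
        all_goals
          simp only [FreeSemigroup.length_mul]
          omega }
  finite := by
    classical
    have : Finite {w : List A // w.length ≤ l} := List.finite_length_le A l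
    let f : FreeSemigroup A → Option {w : List A // w.length ≤ l} := fun w =>
      if h : w.toList.length ≤ l then some ⟨w.toList, h⟩ else none
    refine Finite.of_injective (β := Option {w : List A // w.length ≤ l})
      (fun q => Quotient.liftOn' q f ?_) ?_
    · rintro u v (rfl | ⟨h, h'⟩)
      · rfl
      · simp only [f]
        rw [dif_neg (by rw [FreeSemigroup.length_toList]; omega),
          dif_neg (by rw [FreeSemigroup.length_toList]; omega)]
    · rintro ⟨u⟩ ⟨v⟩ h
      refine Quotient.sound' ?_
      change f u = f v at h
      simp only [f] at h
      split_ifs at h with h1 h2 h2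
      · exact .inl (FreeSemigroup.toList_injective (Subtype.ext_iff.1 (Option.some.inj h)))
      · exact .inr ⟨not_le.1 h1, not_le.1 h2⟩

end FiniteCongruence

/-! ### Approximation of profinite factorizations by factorizations of words. -/

namespace FreeProfiniteSemigroup

open FiniteCongruence

variable {A : Type*}

theorem proj_eq_proj_of_le {c d : FiniteCongruence A} (h : ∀ u v, c.con u v → d.con u v)
    {x y : FreeProfiniteSemigroup A} (hxy : proj c x = proj c y) : proj d x = proj d y := by
  have hx := x.compat c d h
  have hy := y.compat c d h
  change x.val d = y.val d
  rw [← hx, ← hy]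
  exact congrArg _ hxy

theorem exists_word (c : FiniteCongruence A) (x : FreeProfiniteSemigroup A) :
    ∃ w, proj c (ofWord w) = proj c x :=
  c.cls_surjective _

theorem exists_refinement (c d : FiniteCongruence A) : ∃ e : FiniteCongruence A,
    (∀ u v, e.con u v → c.con u v) ∧ ∀ u v, e.con u v → d.con u v := by
  classical
  obtain ⟨e, he⟩ := exists_common_refinement {c, d}
  exact ⟨e, he c (by simp), he d (by simp)⟩

theorem splitRefinement_le (c : FiniteCongruence A) (u v : FreeSemigroup A)
    (h : c.splitRefinement.con u v) : c.con u v :=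
  c.cls_eq_cls.1 h.1

/-- A word that is close enough to a product factorizes accordingly. -/
theorem exists_split {c : FiniteCongruence A} {w : FreeSemigroup A}
    {x y : FreeProfiniteSemigroup A}
    (h : proj c.splitRefinement (ofWord w) = proj c.splitRefinement (x * y)) :
    ∃ u v, w = u * v ∧ proj c (ofWord u) = proj c x ∧ proj c (ofWord v) = proj c y := by
  obtain ⟨u₀, hu₀⟩ := exists_word c.splitRefinement x
  obtain ⟨v₀, hv₀⟩ := exists_word c.splitRefinement y
  rw [map_mul, ← hu₀, ← hv₀, ← map_mul, ← map_mul] at h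
  have h' : c.splittings w = c.splittings (u₀ * v₀) :=
    (c.splitRefinement.cls_eq_cls.1 h).2
  obtain ⟨u, v, rfl, he⟩ : (c.cls u₀, c.cls v₀) ∈ c.splittings w := h' ▸ ⟨u₀, v₀, rfl, rfl⟩
  obtain ⟨h1, h2⟩ := Prod.ext_iff.1 he
  refine ⟨u, v, rfl, ?_, ?_⟩
  · exact (proj_eq_proj_of_le (splitRefinement_le c) hu₀ ▸ h1.symm :)
  · exact (proj_eq_proj_of_le (splitRefinement_le c) hv₀ ▸ h2.symm :)

theorem eq_of_proj_truncation [Finite A] {l : ℕ} {w u : FreeSemigroup A} (hl : u.length ≤ l)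
    (h : proj (truncation l) (ofWord w) = proj (truncation l) (ofWord u)) : w = u := by
  rcases (truncation l).cls_eq_cls.1 h with h | h
  · exact h
  · omega

theorem mem_closure_of_proj {K : Set (FreeProfiniteSemigroup A)} {x : FreeProfiniteSemigroup A}
    (h : ∀ c, ∃ y ∈ K, proj c y = proj c x) : x ∈ closure K := by
  rw [mem_closure_iff]
  rintro U ⟨V, hV, rfl⟩ hx
  obtain ⟨s, t, hst, hsub⟩ := isOpen_pi_iff.1 hV _ hx
  obtain ⟨c, hc⟩ := exists_common_refinement s
  obtain ⟨y, hy, hyx⟩ := h c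
  refine ⟨y, hsub fun d hd => ?_, hy⟩
  have := proj_eq_proj_of_le (hc d hd) hyx
  change proj d y ∈ t d
  rw [this]
  exact (hst d hd).2

/-! ### The idempotent power of a substitution -/

variable (φ : FreeSemigroup A →ₙ* FreeSemigroup A)

theorem extend_iterate_ofWord (n : ℕ) (w : FreeSemigroup A) :
    (extend φ)^[n] (ofWord w) = ofWord (φ^[n] w) := by
  induction n generalizing w with
  | zero => rfl
  | succ n ih => rw [Function.iterate_succ_apply, extend_ofWord, ih, Function.iterate_succ_apply]

variable [Finite A]

/-- Modulo c an iterate of φ is determined by its values on the finitely many letters, so finitely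
many maps occur. -/
theorem exists_period_omega (c : FiniteCongruence A) : ∃ N : ℕ, 0 < N ∧
    ∀ m, 0 < m → N ∣ m → ∀ x, proj c (omega φ x) = proj c ((extend φ)^[m] x) := by
  refine (isOmegaPower_omega φ).exists_period (continuous_proj c) ?_
  refine Set.Finite.of_finite_image (f := fun (h : FreeProfiniteSemigroup A → c.Quot) (a : A) =>
    h (ofWord (FreeSemigroup.of a))) (Set.toFinite _) ?_
  rintro _ ⟨m, rfl⟩ _ ⟨n, rfl⟩ h
  exact congrArg DFunLike.coe (hom_ext (f := (proj c).comp (iterate (extend φ) m))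
    (g := (proj c).comp (iterate (extend φ) n))
    ((continuous_proj c).comp ((continuous_extend φ).iterate m))
    ((continuous_proj c).comp ((continuous_extend φ).iterate n)) (congrFun h))

theorem omega_extend (x : FreeProfiniteSemigroup A) :
    omega φ (extend φ x) = extend φ (omega φ x) := by
  refine tendsto_nhds_unique (isOmegaPower_omega φ (extend φ x)) ?_
  simp only [← Function.iterate_succ_apply, Function.iterate_succ_apply']
  exact ((continuous_extend φ).tendsto _).comp (isOmegaPower_omega φ x)

theorem omega_omega (x : FreeProfiniteSemigroup A) : omega φ (omega φ x) = omega φ x := by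
  refine ext_proj fun c => ?_
  obtain ⟨N, hN, h⟩ := exists_period_omega φ c
  refine tendsto_nhds_unique (((continuous_proj c).comp (continuous_omega φ)).tendsto _ |>.comp
    (isOmegaPower_omega φ x)) (tendsto_const_nhds.congr' ?_)
  filter_upwards [eventually_ge_atTop N] with n hn
  have hd : N ∣ n.factorial := Nat.dvd_factorial hN hn
  simp only [Function.comp_apply]
  rw [h n.factorial n.factorial_pos hd ((extend φ)^[n.factorial] x),
    ← Function.iterate_add_apply, h _ (Nat.add_pos_left n.factorial_pos _) (hd.add hd)]

end FreeProfiniteSemigroup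

/-! ### Combinatorics of the Prouhet-Thue-Morse substitution -/

/-- The exchange of the two letters. -/
def Letter.swap : Letter → Letter
  | .a => .b
  | .b => .a

theorem Letter.ne_swap (x : Letter) : x ≠ x.swap := by cases x <;> nofun

/-- The Prouhet-Thue-Morse substitution on lists of letters. -/
def thueMorseList : List Letter → List Letter
  | [] => []
  | x :: l => x :: x.swap :: thueMorseList l

theorem thueMorseList_append (l m : List Letter) :
    thueMorseList (l ++ m) = thueMorseList l ++ thueMorseList m := by
  induction l with
  | nil => rfl
  | cons x l ih => simp [thueMorseList, ih]

theorem toList_thueMorse (w : FreeSemigroup Letter) :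
    (thueMorse w).toList = thueMorseList w.toList := by
  induction w using FreeSemigroup.recOnMul with
  | ih1 x => cases x <;> rfl
  | ih2 x w _ hw =>
    rw [map_mul, FreeSemigroup.toList_mul, FreeSemigroup.toList_mul, hw, thueMorseList_append]
    congr 1

theorem toList_thueMorse_iterate (n : ℕ) (w : FreeSemigroup Letter) :
    (thueMorse^[n] w).toList = thueMorseList^[n] w.toList := by
  induction n with
  | zero => rfl
  | succ n ih => rw [Function.iterate_succ_apply', Function.iterate_succ_apply', toList_thueMorse,
      ih]

theorem thueMorseList_iterate_append (n : ℕ) (l m : List Letter) :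
    thueMorseList^[n] (l ++ m) = thueMorseList^[n] l ++ thueMorseList^[n] m := by
  induction n with
  | zero => rfl
  | succ n ih => simp only [Function.iterate_succ_apply', ih, thueMorseList_append]

theorem mem_thueMorseList {l : List Letter} (h : l ≠ []) (x : Letter) : x ∈ thueMorseList l := by
  cases l with
  | nil => exact absurd rfl h
  | cons y l => cases x <;> cases y <;> simp [thueMorseList, Letter.swap]

theorem mem_thueMorseList_iterate (n : ℕ) {l : List Letter} (h : ∀ x, x ∈ l) (x : Letter) :
    x ∈ thueMorseList^[n] l := by
  induction n generalizing x with
  | zero => exact h x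
  | succ n ih =>
    rw [Function.iterate_succ_apply']
    exact mem_thueMorseList (List.ne_nil_of_mem (ih .a)) x

/-- If τ(p) sits at an odd offset, each block straddles two consecutive letters of p, or x and the
first of them; the block condition then forces p to be constant. -/
theorem eq_swap_of_thueMorseList_eq_cons {u p t : List Letter} {x : Letter}
    (h : thueMorseList u = x :: (thueMorseList p ++ t)) : ∀ c ∈ p, c = x.swap := by
  induction p generalizing u with
  | nil => simp
  | cons d p ih =>
    match u, h with
    | y :: u, h =>
      simp only [thueMorseList, List.cons_append, List.cons.injEq] at h
      obtain ⟨rfl, rfl, h⟩ := h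
      have hs : ∀ z : Letter, z.swap.swap = z := fun z => by cases z <;> rfl
      rw [hs] at h
      simpa using ih h

theorem exists_of_thueMorseList_eq_append {u p t : List Letter}
    (h : thueMorseList u = thueMorseList p ++ t) : ∃ v, u = p ++ v ∧ t = thueMorseList v := by
  induction p generalizing u with
  | nil => exact ⟨u, rfl, h.symm⟩
  | cons d p ih =>
    match u, h with
    | y :: u, h =>
      simp only [thueMorseList, List.cons_append, List.cons.injEq] at h
      obtain ⟨rfl, -, h⟩ := h
      obtain ⟨v, rfl, rfl⟩ := ih h
      exact ⟨v, rfl, rfl⟩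

/-- Synchronization: the image of a word with two distinct letters occurs only at the expected
places in an image. -/
theorem thueMorseList_synchronizing {p t : List Letter} (hp : ∀ x, x ∈ p) :
    ∀ {s u : List Letter}, thueMorseList u = s ++ (thueMorseList p ++ t) →
      ∃ s' t', u = s' ++ (p ++ t') ∧ s = thueMorseList s' ∧ t = thueMorseList t'
  | [], u, h => by
    obtain ⟨v, rfl, rfl⟩ := exists_of_thueMorseList_eq_append h
    exact ⟨[], v, rfl, rfl, rfl⟩
  | [x], u, h => by
    have := eq_swap_of_thueMorseList_eq_cons h
    exact absurd (this x (hp x)) x.ne_swap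
  | x :: y :: s, [], h => by simp [thueMorseList] at h
  | x :: y :: s, z :: u, h => by
    simp only [thueMorseList, List.cons_append, List.cons.injEq] at h
    obtain ⟨rfl, rfl, h⟩ := h
    obtain ⟨s', t', rfl, rfl, rfl⟩ := thueMorseList_synchronizing hp h
    exact ⟨z :: s', t', rfl, rfl, rfl⟩

theorem thueMorseList_iterate_synchronizing (n : ℕ) {p s t u : List Letter} (hp : ∀ x, x ∈ p)
    (h : thueMorseList^[n] u = s ++ (thueMorseList^[n] p ++ t)) :
    ∃ s' t', u = s' ++ (p ++ t') ∧ s = thueMorseList^[n] s' ∧ t = thueMorseList^[n] t' := by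
  induction n generalizing s t with
  | zero => exact ⟨s, t, h, rfl, rfl⟩
  | succ n ih =>
    simp only [Function.iterate_succ_apply'] at h ⊢
    obtain ⟨s', t', h', rfl, rfl⟩ :=
      thueMorseList_synchronizing (mem_thueMorseList_iterate n hp) h
    obtain ⟨s'', t'', rfl, rfl, rfl⟩ := ih h'
    exact ⟨s'', t'', rfl, rfl, rfl⟩

/-! ### Return words to a.a and the substitution induced by τ². -/

/-- The words that separate consecutive occurrences of `a.a`. -/
inductive ReturnWord where
  | α : ReturnWord
  | β : ReturnWord
  | γ : ReturnWord
  | δ : ReturnWord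

/-- The code homomorphism that spells out the return words. -/
def returnCode : FreeSemigroup ReturnWord →ₙ* FreeSemigroup Letter :=
  FreeSemigroup.lift fun
    | .α => ⟨.a, [.b, .b, .a]⟩
    | .β => ⟨.a, [.b, .a, .b, .b, .a]⟩
    | .γ => ⟨.a, [.b, .b, .a, .b, .a]⟩
    | .δ => ⟨.a, [.b, .a, .b, .b, .a, .b, .a]⟩

/-- The action of the square of the Prouhet-Thue-Morse substitution on return words. -/
def returnSubstitution : FreeSemigroup ReturnWord →ₙ* FreeSemigroup ReturnWord :=
  FreeSemigroup.lift fun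
    | .α => ⟨.γ, [.α, .β]⟩
    | .β => ⟨.γ, [.δ, .α, .β]⟩
    | .γ => ⟨.γ, [.α, .δ, .β]⟩
    | .δ => ⟨.γ, [.δ, .α, .δ, .β]⟩

theorem returnCode_returnSubstitution (v : FreeSemigroup ReturnWord) :
    returnCode (returnSubstitution v) = thueMorse (thueMorse (returnCode v)) := by
  have : returnCode.comp returnSubstitution = (thueMorse.comp thueMorse).comp returnCode :=
    FreeSemigroup.hom_ext (funext fun x => by cases x <;> rfl)
  exact DFunLike.congr_fun this v

theorem returnCode_returnSubstitution_iterate (m : ℕ) (v : FreeSemigroup ReturnWord) :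
    returnCode (returnSubstitution^[m] v) = thueMorse^[2 * m] (returnCode v) := by
  induction m with
  | zero => rfl
  | succ m ih =>
    rw [Function.iterate_succ_apply', returnCode_returnSubstitution, ih, Nat.mul_succ,
      Function.iterate_succ_apply', Function.iterate_succ_apply']

/-- With τ²(a) = abba and τ²(b) = baab, the prefixes abba, ababba and ab are the possible pending
pieces while blocks are read from left to right. Each further block completes a return word or
passes to another pending piece, so the three claims are proved together. The final letter a makes
the word end at a cut. -/
theorem exists_returnCode_eq (l : List Letter) :
    (∃ v, (returnCode v).toList =
      [.a, .b, .b, .a] ++ thueMorseList (thueMorseList (l ++ [.a]))) ∧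
    (∃ v, (returnCode v).toList =
      [.a, .b, .a, .b, .b, .a] ++ thueMorseList (thueMorseList (l ++ [.a]))) ∧
    ∃ v, (returnCode v).toList = [.a, .b] ++ thueMorseList (thueMorseList (l ++ [.a])) := by
  have key : ∀ (r : ReturnWord) {m : List Letter}, (∃ v, (returnCode v).toList = m) →
      ∃ v, (returnCode v).toList = (returnCode (FreeSemigroup.of r)).toList ++ m := by
    rintro r _ ⟨v, rfl⟩
    exact ⟨.of r * v, by rw [map_mul, FreeSemigroup.toList_mul]⟩
  induction l with
  | nil => exact ⟨⟨⟨.α, [.α]⟩, rfl⟩, ⟨⟨.β, [.α]⟩, rfl⟩, ⟨⟨.β, []⟩, rfl⟩⟩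
  | cons x l ih =>
    obtain ⟨h1, h2, h3⟩ := ih
    cases x
    · exact ⟨key .α h1, key .β h1, h2⟩
    · exact ⟨key .γ h3, key .δ h3, key .α h3⟩

/-- A factor of `τ^k(a)` that begins and ends with `τ^(n+2)(abba)` is the image under `τ^n` of a
product of return words. -/
theorem exists_iterate_returnCode_eq {n k : ℕ} (hk : n + 2 ≤ k) {y z : FreeSemigroup Letter}
    (h : thueMorse^[k] (.of .a) = thueMorse^[n + 2] (genWord .α) * y *
      thueMorse^[n + 2] (genWord .α) * z) :
    ∃ v, thueMorse^[n + 2] (genWord .α) * y * thueMorse^[n + 2] (genWord .α) =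
      thueMorse^[n] (returnCode v) := by
  have hmem : ∀ x, x ∈ (genWord .α).toList := fun x => by
    cases x <;> simp [genWord, FreeSemigroup.toList]
  obtain ⟨j, rfl⟩ := Nat.exists_eq_add_of_le hk
  have h' := congrArg FreeSemigroup.toList h
  rw [Function.iterate_add_apply] at h'
  simp only [FreeSemigroup.toList_mul, toList_thueMorse_iterate (n + 2), List.append_assoc] at h'
  obtain ⟨s, t, -, hs, ht⟩ := thueMorseList_iterate_synchronizing (n + 2) (s := []) hmem h'
  obtain ⟨y', z', -, hy, -⟩ := thueMorseList_iterate_synchronizing (n + 2) hmem ht.symm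
  -- Synchronization gives y = τ^(n+2)(y'). Since τ²(a) = abba, the word τ²(abba y' abba) is abba
  -- followed by τ²(bba y' abb · a).
  obtain ⟨⟨v, hv⟩, -⟩ := exists_returnCode_eq ([.b, .b, .a] ++ y' ++ [.a, .b, .b])
  refine ⟨v, FreeSemigroup.toList_injective ?_⟩
  rw [FreeSemigroup.toList_mul, FreeSemigroup.toList_mul, toList_thueMorse_iterate,
    toList_thueMorse_iterate, hy, hv, ← thueMorseList_iterate_append,
    ← thueMorseList_iterate_append, Function.iterate_add_apply]
  congr 1
  simp [thueMorseList, thueMorseList_append, genWord, FreeSemigroup.toList, Letter.swap]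

open FreeProfiniteSemigroup

/-! ### The group of the Prouhet-Thue-Morse substitution -/

theorem thueMorse_iterate_of_a_prefix_mul {k n : ℕ} (h : k < n) :
    ∃ s, thueMorse^[n] (.of .a) = thueMorse^[k] (.of .a) * s := by
  have key : ∀ m, ∃ s, thueMorse^[m + 1] (.of .a) = .of .a * s := by
    intro m
    induction m with
    | zero => exact ⟨.of .b, rfl⟩
    | succ m ih =>
      obtain ⟨s, hs⟩ := ih
      refine ⟨s * thueMorse^[m + 1] (.of .b), ?_⟩
      rw [Function.iterate_succ_apply, show thueMorse (.of .a) = .of .a * .of .b from rfl,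
        iterate_map_mul, hs, mul_assoc]
  obtain ⟨m, rfl⟩ := Nat.exists_eq_add_of_lt h
  obtain ⟨s, hs⟩ := key m
  exact ⟨thueMorse^[k] s, by rw [add_assoc, Function.iterate_add_apply, hs, iterate_map_mul]⟩

/-- Parity matters because τ²(a) = abba ends with a, while τ(a) = ab does not. -/
theorem thueMorse_iterate_of_a_suffix_mul {k n : ℕ} (h : k < n) (hk : Even k) (hn : Even n) :
    ∃ s, thueMorse^[n] (.of .a) = s * thueMorse^[k] (.of .a) := by
  have key : ∀ m, ∃ s, thueMorse^[2 * m + 2] (.of .a) = s * .of .a := by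
    intro m
    induction m with
    | zero => exact ⟨⟨.a, [.b, .b]⟩, rfl⟩
    | succ m ih =>
      obtain ⟨s, hs⟩ := ih
      refine ⟨thueMorse^[2 * m + 2] ⟨.a, [.b, .b]⟩ * s, ?_⟩
      rw [show 2 * (m + 1) + 2 = (2 * m + 2) + 2 by ring, Function.iterate_add_apply _ (2 * m + 2),
        show thueMorse^[2] (.of .a) = ⟨.a, [.b, .b]⟩ * .of .a from rfl,
        iterate_map_mul, hs, mul_assoc]
  obtain ⟨m, rfl⟩ : ∃ m, n = k + (2 * m + 2) := by
    obtain ⟨i, rfl⟩ := hk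
    obtain ⟨j, rfl⟩ := hn
    exact ⟨j - i - 1, by omega⟩
  obtain ⟨s, hs⟩ := key m
  exact ⟨thueMorse^[k] s, by rw [Function.iterate_add_apply, hs, iterate_map_mul]⟩

/-- Passes closed conditions to the limit; n! is even for n ≥ 2, so it suffices to test even
exponents. -/
theorem omega_thueMorse_mem {K : Set (FreeProfiniteSemigroup Letter)} (hK : IsClosed K) (k : ℕ)
    (h : ∀ n, k < n → Even n → ofWord (thueMorse^[n] (.of .a)) ∈ K) :
    omega thueMorse (ofWord (.of .a)) ∈ K := by
  refine hK.mem_of_tendsto (isOmegaPower_omega thueMorse _) ?_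
  filter_upwards [eventually_gt_atTop (k + 2)] with n hn
  rw [extend_iterate_ofWord]
  exact h _ ((by omega : k < n).trans_le n.self_le_factorial)
    (even_iff_two_dvd.2 (Nat.dvd_factorial two_pos (by omega)))

theorem omega_thueMorse_prefix_mul (k : ℕ) :
    ∃ s, omega thueMorse (ofWord (.of .a)) = ofWord (thueMorse^[k] (.of .a)) * s :=
  omega_thueMorse_mem (isClosed_range_mul_left _) k fun n hn _ => by
    obtain ⟨s, hs⟩ := thueMorse_iterate_of_a_prefix_mul hn
    exact ⟨ofWord s, by rw [hs, map_mul]⟩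

theorem omega_thueMorse_suffix_mul {k : ℕ} (hk : Even k) :
    ∃ s, omega thueMorse (ofWord (.of .a)) = s * ofWord (thueMorse^[k] (.of .a)) :=
  omega_thueMorse_mem (isClosed_range_mul_right _) k fun n hn hn' => by
    obtain ⟨s, hs⟩ := thueMorse_iterate_of_a_suffix_mul hn hk hn'
    exact ⟨ofWord s, by rw [hs, map_mul]⟩

theorem omega_thueMorse_eq_factor {k : ℕ} {p u q : FreeSemigroup Letter}
    (h : thueMorse^[k] (.of .a) = p * u * q) :
    ∃ x y, omega thueMorse (ofWord (.of .a)) = x * omega thueMorse (ofWord u) * y := by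
  obtain ⟨x, y, hxy⟩ : ∃ x y, omega thueMorse (ofWord (.of .a)) = x * ofWord u * y :=
    omega_thueMorse_mem (isClosed_setOf_factor _) k fun n hn _ => by
      obtain ⟨s, hs⟩ := thueMorse_iterate_of_a_prefix_mul hn
      exact ⟨ofWord p, ofWord (q * s), by rw [hs, h, ← map_mul, ← map_mul, mul_assoc (p * u)]⟩
  -- Applying the idempotent τ^ω to both sides fixes τ^ω(a) and replaces u by τ^ω(u).
  refine ⟨omega thueMorse x, omega thueMorse y, ?_⟩
  rw [← map_mul, ← map_mul, ← hxy, omega_omega]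

/-- Words of the language that begin and end with `a` give elements of the group. -/
theorem omega_thueMorse_mem_thueMorseGroup {k : ℕ} {p u q s t : FreeSemigroup Letter}
    (h : thueMorse^[k] (.of .a) = p * u * q) (hs : u = .of .a * s) (ht : u = t * .of .a) :
    omega thueMorse (ofWord u) ∈ thueMorseGroup := by
  obtain ⟨x, y, hxy⟩ := omega_thueMorse_eq_factor h
  have hs' : omega thueMorse (ofWord u) =
      omega thueMorse (ofWord (.of .a)) * omega thueMorse (ofWord s) := by
    rw [hs, map_mul, map_mul]
  have ht' : omega thueMorse (ofWord u) =
      omega thueMorse (ofWord t) * omega thueMorse (ofWord (.of .a)) := by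
    rw [ht, map_mul, map_mul]
  exact ⟨⟨.inr ⟨_, hs'⟩, .inr (exists_eq_mul_of_factor hxy hs')⟩,
    .inr ⟨_, ht'⟩, .inr (exists_eq_mul_of_factor' hxy ht')⟩

theorem omega_thueMorse_genWord_mem (x : Gen) :
    omega thueMorse (ofWord (genWord x)) ∈ thueMorseGroup := by
  cases x
  · exact omega_thueMorse_mem_thueMorseGroup (k := 4) (p := ⟨.a, [.b, .b, .a, .b, .a]⟩)
      (q := ⟨.a, [.b, .a, .b, .b, .a]⟩) (s := ⟨.b, [.b, .a]⟩) (t := ⟨.a, [.b, .b]⟩) rfl rfl rfl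
  · exact omega_thueMorse_mem_thueMorseGroup (k := 5)
      (p := ⟨.a, [.b, .b, .a, .b, .a, .a, .b, .b, .a]⟩)
      (q := thueMorse^[4] (.of .b)) (s := ⟨.b, [.a, .b, .b, .a]⟩)
      (t := ⟨.a, [.b, .a, .b, .b]⟩) rfl rfl rfl
  · exact omega_thueMorse_mem_thueMorseGroup (k := 6) (p := thueMorse^[4] ⟨.a, [.b, .b]⟩)
      (q := ⟨.a, [.b, .b, .a, .a, .b, .a, .b, .b, .a]⟩) (s := ⟨.b, [.b, .a, .b, .a]⟩)
      (t := ⟨.a, [.b, .b, .a, .b]⟩) rfl rfl rfl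

theorem exists_thueMorseGroup_eq_unitsAt :
    ∃ e : FreeProfiniteSemigroup Letter, e * e = e ∧ thueMorseGroup = unitsAt e := by
  have h : omega thueMorse (ofWord ⟨.a, [.a]⟩) ∈ thueMorseGroup :=
    omega_thueMorse_mem_thueMorseGroup (k := 4) (p := ⟨.a, [.b, .b, .a, .b]⟩)
      (q := ⟨.b, [.b, .a, .a, .b, .a, .b, .b, .a]⟩) (s := .of .a) (t := .of .a) rfl rfl rfl
  have hsq : omega thueMorse (ofWord ⟨.a, [.a]⟩) =
      omega thueMorse (ofWord (.of .a)) * omega thueMorse (ofWord (.of .a)) := by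
    rw [← map_mul, ← map_mul]; rfl
  have key : (∃ t, omega thueMorse (ofWord (.of .a)) = omega thueMorse (ofWord ⟨.a, [.a]⟩) * t) ∧
      ∃ t, omega thueMorse (ofWord (.of .a)) = t * omega thueMorse (ofWord ⟨.a, [.a]⟩) := by
    obtain ⟨x, y, hxy⟩ := omega_thueMorse_eq_factor (k := 4) (p := ⟨.a, [.b, .b, .a, .b]⟩)
      (u := ⟨.a, [.a]⟩) (q := ⟨.b, [.b, .a, .a, .b, .a, .b, .b, .a]⟩) rfl
    exact ⟨exists_eq_mul_of_factor hxy hsq, exists_eq_mul_of_factor' hxy hsq⟩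
  obtain ⟨⟨t, ht⟩, t', ht'⟩ := key
  rw [hsq] at ht ht'
  exact exists_greenClass_eq_unitsAt ht ht'

theorem isMaximalSubgroup_thueMorseGroup : IsMaximalSubgroup thueMorseGroup := by
  obtain ⟨e, he, h⟩ := exists_thueMorseGroup_eq_unitsAt
  exact h ▸ isMaximalSubgroup_unitsAt he

theorem isClosed_thueMorseGroup : IsClosed thueMorseGroup := by
  obtain ⟨e, -, h⟩ := exists_thueMorseGroup_eq_unitsAt
  exact h ▸ isClosed_unitsAt e

noncomputable instance : Group thueMorseGroup := isMaximalSubgroup_thueMorseGroup.isSubgroup.group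

theorem thueMorseGroup_coe_mul (x y : thueMorseGroup) :
    ((x * y : thueMorseGroup) : FreeProfiniteSemigroup Letter) = x * y := rfl

instance : CompactSpace thueMorseGroup :=
  isCompact_iff_compactSpace.1 isClosed_thueMorseGroup.isCompact

instance : ContinuousMul thueMorseGroup where
  continuous_mul := Continuous.subtype_mk (by fun_prop) _

instance : IsTopologicalGroup thueMorseGroup := isTopologicalGroup_of_compactSpace _

/-- The element `τ^ω(a)` of the group. -/
noncomputable def thueMorseBase : thueMorseGroup :=
  ⟨omega thueMorse (ofWord (.of .a)), ⟨.inl rfl, .inl rfl⟩, .inl rfl, .inl rfl⟩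

/-- In the group, x = g(g⁻¹xg⁻¹)g with g = τ^ω(a), and g itself begins and, for even k, ends with
τ^k(a). -/
theorem exists_eq_mul_mul_of_mem {x : FreeProfiniteSemigroup Letter} (hx : x ∈ thueMorseGroup)
    {k : ℕ} (hk : Even k) : ∃ y, x = ofWord (thueMorse^[k] (.of .a)) * y *
      ofWord (thueMorse^[k] (.of .a)) := by
  obtain ⟨s, hs⟩ := omega_thueMorse_prefix_mul k
  obtain ⟨t, ht⟩ := omega_thueMorse_suffix_mul hk
  have h : (⟨x, hx⟩ : thueMorseGroup) =
      thueMorseBase * (thueMorseBase⁻¹ * ⟨x, hx⟩ * thueMorseBase⁻¹) * thueMorseBase := by group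
  set y : thueMorseGroup := thueMorseBase⁻¹ * ⟨x, hx⟩ * thueMorseBase⁻¹
  have h' : x = omega thueMorse (ofWord (.of .a)) * y.1 * omega thueMorse (ofWord (.of .a)) :=
    congrArg Subtype.val h
  refine ⟨s * y.1 * t, ?_⟩
  rw [h']
  nth_rewrite 1 [hs]
  rw [ht]
  simp only [mul_assoc]

theorem exists_omega_thueMorse_eq_mul {x : FreeProfiniteSemigroup Letter}
    (hx : x ∈ thueMorseGroup) : ∃ z, omega thueMorse (ofWord (.of .a)) = x * z := by
  have h : thueMorseBase = (⟨x, hx⟩ : thueMorseGroup) * (⟨x, hx⟩⁻¹ * thueMorseBase) := by group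
  exact ⟨_, congrArg Subtype.val h⟩

theorem exists_proj_omega_thueMorse_eq (c : FiniteCongruence Letter) (N : ℕ) :
    ∃ k ≥ N, proj c (omega thueMorse (ofWord (.of .a))) =
      proj c (ofWord (thueMorse^[k] (.of .a))) := by
  obtain ⟨M, hM, h⟩ := exists_period_omega thueMorse c
  exact ⟨M * (N + 1), by nlinarith, by
    rw [h (M * (N + 1)) (by positivity) (dvd_mul_right _ _), extend_iterate_ofWord]⟩

theorem le_length_thueMorse_iterate (k : ℕ) (w : FreeSemigroup Letter) :
    k < (thueMorse^[k] w).length := by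
  induction k with
  | zero => exact w.length_pos
  | succ k ih =>
    have : ∀ l : List Letter, (thueMorseList l).length = 2 * l.length := by
      intro l
      induction l with
      | nil => rfl
      | cons x l ih => simp only [thueMorseList, List.length_cons, ih]; ring
    rw [Function.iterate_succ_apply', ← FreeSemigroup.length_toList, toList_thueMorse, this,
      FreeSemigroup.length_toList]
    omega

theorem thueMorseGroup_subset_substitutionJClass :
    thueMorseGroup ⊆ substitutionJClass thueMorse := by
  intro x hx
  constructor
  · refine mem_closure_of_proj fun c => ?_
    obtain ⟨z, hz⟩ := exists_omega_thueMorse_eq_mul hx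
    -- Since x is a left factor of τ^ω(a), a suitable prefix of τ^k(a) approximates x.
    obtain ⟨k, -, hk⟩ := exists_proj_omega_thueMorse_eq c.splitRefinement 0
    rw [hz] at hk
    obtain ⟨u, v, huv, hu, -⟩ := exists_split hk.symm
    refine ⟨_, ⟨u, fun N => ⟨k + N + 1, by omega, .a, ?_⟩, rfl⟩, hu⟩
    obtain ⟨s, hs⟩ := thueMorse_iterate_of_a_prefix_mul (k := k) (n := k + N + 1) (by omega)
    change u.toList <:+: (thueMorse^[k + N + 1] (.of .a)).toList
    rw [hs, huv, mul_assoc, FreeSemigroup.toList_mul]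
    exact (List.prefix_append _ _).isInfix
  · rintro ⟨w, -, rfl⟩
    -- A finite word w in the group would have a prefix τ^(2|w|)(a), which is longer than w.
    obtain ⟨y, hy⟩ := exists_eq_mul_mul_of_mem hx (k := 2 * w.length) (even_two_mul _)
    obtain ⟨y₀, hy₀⟩ := exists_word (FiniteCongruence.truncation w.length)
      (y * ofWord (thueMorse^[2 * w.length] (.of .a)))
    have h : proj (FiniteCongruence.truncation w.length)
        (ofWord (thueMorse^[2 * w.length] (.of .a) * y₀)) =
        proj (FiniteCongruence.truncation w.length) (ofWord w) := by
      rw [hy, mul_assoc, map_mul, map_mul, map_mul _ (ofWord _), hy₀]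
    have h1 := congrArg FreeSemigroup.length (eq_of_proj_truncation le_rfl h)
    have h2 := le_length_thueMorse_iterate (2 * w.length) (.of .a)
    rw [FreeSemigroup.length_mul] at h1
    omega

/-- Every element of the group is a limit of images of products of return words. -/
theorem exists_proj_eq_proj_returnCode {x : FreeProfiniteSemigroup Letter}
    (hx : x ∈ thueMorseGroup) (c : FiniteCongruence Letter) {n : ℕ} (hn : Even n) :
    ∃ v, proj c (ofWord (thueMorse^[n] (returnCode v))) = proj c x := by
  set P : FreeSemigroup Letter := thueMorse^[n + 2] (genWord .α) with hP
  have hP' : P = thueMorse^[n + 4] (.of .a) := by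
    rw [hP, show n + 4 = (n + 2) + 2 by ring, Function.iterate_add_apply _ (n + 2)]
    rfl
  obtain ⟨y, hy⟩ := exists_eq_mul_mul_of_mem hx (k := n + 4) (hn.add (by decide))
  rw [← hP'] at hy
  obtain ⟨z, hz⟩ := exists_omega_thueMorse_eq_mul hx
  obtain ⟨d, hdc, hdl⟩ := exists_refinement c (FiniteCongruence.truncation P.length)
  -- One refinement is spent on each of three cuts: τ^k(a) into approximations of x and z, then
  -- removal of the right factor P, then of the left one. The truncation congruence makes the
  -- approximations of P equal to P.
  obtain ⟨k, hk, hkd⟩ := exists_proj_omega_thueMorse_eq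
    d.splitRefinement.splitRefinement.splitRefinement (n + 2)
  rw [hz] at hkd
  obtain ⟨w, z', hw, hwx, -⟩ := exists_split hkd.symm
  have hwc : proj c (ofWord w) = proj c x :=
    proj_eq_proj_of_le (fun u v h => hdc u v (splitRefinement_le _ u v
      (splitRefinement_le _ u v h))) hwx
  rw [hy] at hwx
  obtain ⟨w', u₃, rfl, hw', h₃⟩ := exists_split hwx
  obtain ⟨u₁, u₂, rfl, h₁, -⟩ := exists_split hw'
  have e₁ : u₁ = P := eq_of_proj_truncation le_rfl (proj_eq_proj_of_le hdl h₁)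
  have e₃ : u₃ = P := eq_of_proj_truncation le_rfl
    (proj_eq_proj_of_le (fun u v h => hdl u v (splitRefinement_le _ u v h)) h₃)
  subst e₁ e₃
  obtain ⟨v, hv⟩ := exists_iterate_returnCode_eq hk hw
  exact ⟨v, by rw [← hv]; exact hwc⟩

/-! ### The generators of the group -/

/-- The elements of the free profinite group represented by the return words. -/
def returnValue : ReturnWord → FreeProfiniteGroup Gen
  | .α => FreeProfiniteGroup.of .α
  | .β => FreeProfiniteGroup.of .β
  | .γ => FreeProfiniteGroup.of .γ
  | .δ => FreeProfiniteGroup.of .β * (FreeProfiniteGroup.of .α)⁻¹ * FreeProfiniteGroup.of .γ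

/-- The element of the free profinite group represented by a product of return words. -/
def returnDecode : FreeSemigroup ReturnWord →ₙ* FreeProfiniteGroup Gen :=
  FreeSemigroup.lift returnValue

theorem returnDecode_of (x : ReturnWord) : returnDecode (.of x) = returnValue x :=
  FreeSemigroup.lift_of _ _

theorem bigPsi_of (x : Gen) : bigPsi (FreeProfiniteGroup.of x) = psiValue x :=
  FreeProfiniteGroup.lift_of psiValue x

/-- The values of Ψ are those of `returnSubstitution` with δ replaced by βα⁻¹γ; the case of δ checks
that this replacement is consistent. -/
theorem bigPsi_returnDecode (v : FreeSemigroup ReturnWord) :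
    bigPsi (returnDecode v) = returnDecode (returnSubstitution v) := by
  induction v using FreeSemigroup.recOnMul with
  | ih1 x =>
    rw [returnDecode_of]
    cases x
    · rw [show returnSubstitution (.of .α) = .of .γ * .of .α * .of .β from rfl]
      simp only [map_mul, returnDecode_of, returnValue, bigPsi_of, psiValue]
    · rw [show returnSubstitution (.of .β) = .of .γ * .of .δ * .of .α * .of .β from rfl]
      simp only [map_mul, returnDecode_of, returnValue, bigPsi_of, psiValue, mul_assoc]
    · rw [show returnSubstitution (.of .γ) = .of .γ * .of .α * .of .δ * .of .β from rfl]
      simp only [map_mul, returnDecode_of, returnValue, bigPsi_of, psiValue, mul_assoc]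
    · rw [show returnSubstitution (.of .δ) = .of .γ * .of .δ * .of .α * .of .δ * .of .β from rfl]
      simp only [map_mul, map_inv, returnDecode_of, returnValue, bigPsi_of, psiValue]
      group
  | ih2 x v hx hv => rw [map_mul, map_mul, map_mul, map_mul, hx, hv]

theorem bigPsi_iterate_returnDecode (m : ℕ) (v : FreeSemigroup ReturnWord) :
    bigPsi^[m] (returnDecode v) = returnDecode (returnSubstitution^[m] v) := by
  induction m with
  | zero => rfl
  | succ m ih =>
    rw [Function.iterate_succ_apply', Function.iterate_succ_apply', ih, bigPsi_returnDecode]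

/-- The homomorphism from the free profinite group onto the group of the substitution. -/
noncomputable def thueMorsePi : FreeProfiniteGroup Gen →ₜ* thueMorseGroup :=
  FreeProfiniteGroup.lift (P := ProfiniteGrp.of thueMorseGroup) fun x =>
    (⟨omega thueMorse (ofWord (genWord x)), omega_thueMorse_genWord_mem x⟩ : thueMorseGroup)

theorem thueMorsePi_of (x : Gen) :
    (thueMorsePi (FreeProfiniteGroup.of x) : FreeProfiniteSemigroup Letter) =
      omega thueMorse (ofWord (genWord x)) :=
  congrArg Subtype.val (FreeProfiniteGroup.lift_of (P := ProfiniteGrp.of thueMorseGroup) (fun x =>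
    (⟨omega thueMorse (ofWord (genWord x)), omega_thueMorse_genWord_mem x⟩ : thueMorseGroup)) x)

theorem continuous_coe_thueMorsePi :
    Continuous fun u => (thueMorsePi u : FreeProfiniteSemigroup Letter) :=
  continuous_subtype_val.comp thueMorsePi.continuous_toFun

theorem thueMorsePi_returnDecode (v : FreeSemigroup ReturnWord) :
    (thueMorsePi (returnDecode v) : FreeProfiniteSemigroup Letter) =
      omega thueMorse (ofWord (returnCode v)) := by
  induction v using FreeSemigroup.recOnMul with
  | ih1 x =>
    rw [returnDecode_of]
    cases x
    · exact thueMorsePi_of .α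
    · exact thueMorsePi_of .β
    · exact thueMorsePi_of .γ
    · rw [show returnCode (.of .δ) = ⟨.a, [.b]⟩ * genWord .γ from rfl, returnValue]
      -- Here ababba = ab · abba and δ = ab · abbaba. The factor τ^ω(ab) need not lie in the group,
      -- so the cancellation of π(α) is done to its right.
      have hβ : (thueMorsePi (FreeProfiniteGroup.of .β) : FreeProfiniteSemigroup Letter) =
          omega thueMorse (ofWord ⟨.a, [.b]⟩) * thueMorsePi (FreeProfiniteGroup.of .α) := by
        rw [thueMorsePi_of, thueMorsePi_of, ← map_mul, ← map_mul]
        rfl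
      rw [mul_assoc, map_mul, thueMorseGroup_coe_mul, hβ, mul_assoc, ← thueMorseGroup_coe_mul,
        ← map_mul, mul_inv_cancel_left, thueMorsePi_of, map_mul, map_mul]
  | ih2 x v hx hv => simp only [map_mul, thueMorseGroup_coe_mul, hx, hv]

/-- Modulo c, a suitable power τ^(2N) agrees with τ^ω, so the approximations of x by τ^(2N)-images
become approximations by τ^ω-images. -/
theorem mem_closure_of_mem_thueMorseGroup {x : FreeProfiniteSemigroup Letter}
    (hx : x ∈ thueMorseGroup) :
    x ∈ closure (Set.range fun v => omega thueMorse (ofWord (returnCode v))) := by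
  refine mem_closure_of_proj fun c => ?_
  obtain ⟨N, hN, h⟩ := exists_period_omega thueMorse c
  obtain ⟨v, hv⟩ := exists_proj_eq_proj_returnCode hx c (even_two_mul N)
  exact ⟨_, ⟨v, rfl⟩, by
    rw [← hv, h (2 * N) (by omega) (dvd_mul_left _ _), extend_iterate_ofWord]⟩

theorem thueMorsePi_surjective : Function.Surjective thueMorsePi := by
  intro x
  have hclosed : IsClosed (Set.range fun u =>
      (thueMorsePi u : FreeProfiniteSemigroup Letter)) :=
    (isCompact_range continuous_coe_thueMorsePi).isClosed
  obtain ⟨u, hu⟩ := closure_minimal (by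
    rintro _ ⟨v, rfl⟩
    exact ⟨_, thueMorsePi_returnDecode v⟩) hclosed (mem_closure_of_mem_thueMorseGroup x.2)
  exact ⟨u, Subtype.ext hu⟩

/-- The group is contained in the closure of the image of the idempotent τ^ω, and the fixed points
of τ^ω form a closed set. -/
theorem omega_thueMorse_eq_self {x : FreeProfiniteSemigroup Letter} (hx : x ∈ thueMorseGroup) :
    omega thueMorse x = x := by
  have hclosed : IsClosed {x | omega thueMorse x = x} :=
    isClosed_eq (continuous_omega _) continuous_id
  exact closure_minimal (by rintro _ ⟨v, rfl⟩; exact omega_omega _ _) hclosed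
    (mem_closure_of_mem_thueMorseGroup hx)

/-! ### The automorphism induced by the square of the substitution -/

theorem extend_extend_mem_thueMorseGroup {x : FreeProfiniteSemigroup Letter}
    (hx : x ∈ thueMorseGroup) : extend thueMorse (extend thueMorse x) ∈ thueMorseGroup := by
  have h : extend thueMorse (extend thueMorse (omega thueMorse (ofWord (.of .a)))) =
      omega thueMorse (ofWord (genWord .α)) := by
    rw [← omega_extend, ← omega_extend]
    rfl
  have hα := h ▸ omega_thueMorse_genWord_mem .α
  exact ⟨(hx.1.map ((extend thueMorse).comp (extend thueMorse))).trans hα.1,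
    (hx.2.map ((extend thueMorse).comp (extend thueMorse))).trans hα.2⟩

/-- The endomorphism of the group induced by the square of the substitution. -/
noncomputable def thueMorseEnd : thueMorseGroup →ₜ* thueMorseGroup where
  toMonoidHom := MonoidHom.mk'
    (fun x => ⟨_, extend_extend_mem_thueMorseGroup x.2⟩) fun x y => Subtype.ext <| by
      simp only [thueMorseGroup_coe_mul, map_mul]
  continuous_toFun := Continuous.subtype_mk ((continuous_extend _).comp
    ((continuous_extend _).comp continuous_subtype_val)) _

theorem thueMorseEnd_coe (x : thueMorseGroup) :
    (thueMorseEnd x : FreeProfiniteSemigroup Letter) = extend thueMorse (extend thueMorse x) := rfl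

theorem thueMorseEnd_iterate_coe (m : ℕ) (x : thueMorseGroup) :
    (thueMorseEnd^[m] x : FreeProfiniteSemigroup Letter) = (extend thueMorse)^[2 * m] x := by
  induction m with
  | zero => rfl
  | succ m ih =>
    rw [Function.iterate_succ_apply', thueMorseEnd_coe, ih, Nat.mul_succ,
      Function.iterate_succ_apply', Function.iterate_succ_apply']

theorem tendsto_thueMorseEnd_iterate (x : thueMorseGroup) :
    Tendsto (fun n : ℕ => thueMorseEnd^[n.factorial] x) atTop (𝓝 x) := by
  rw [tendsto_subtype_rng]
  simp only [thueMorseEnd_iterate_coe]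
  refine isInducing_val.tendsto_nhds_iff.2 (tendsto_pi_nhds.2 fun c =>
    tendsto_const_nhds.congr' ?_)
  obtain ⟨N, hN, h⟩ := exists_period_omega thueMorse c
  filter_upwards [eventually_ge_atTop N] with n hn
  have := h (2 * n.factorial) (by have := n.factorial_pos; omega)
    (dvd_mul_of_dvd_right (Nat.dvd_factorial hN hn) _) x.1
  rw [omega_thueMorse_eq_self x.2] at this
  exact this

/-- The iterates of exponent n! are positive powers converging pointwise to the identity. So equal
images force equal limits, and each x is a limit of elements of the compact image. -/
theorem thueMorseEnd_bijective : Function.Bijective thueMorseEnd := by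
  constructor
  · intro x y h
    refine tendsto_nhds_unique (tendsto_thueMorseEnd_iterate x)
      ((tendsto_thueMorseEnd_iterate y).congr fun n => ?_)
    obtain ⟨m, hm⟩ := Nat.exists_eq_succ_of_ne_zero n.factorial_ne_zero
    rw [hm, Function.iterate_succ_apply, Function.iterate_succ_apply, h]
  · intro x
    refine (isCompact_range thueMorseEnd.continuous_toFun).isClosed.mem_of_tendsto
      (tendsto_thueMorseEnd_iterate x) (Eventually.of_forall fun n => ?_)
    obtain ⟨m, hm⟩ := Nat.exists_eq_succ_of_ne_zero n.factorial_ne_zero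
    rw [hm, Function.iterate_succ_apply']
    exact ⟨_, rfl⟩

/-- The automorphism of the group induced by the square of the substitution. -/
noncomputable def thueMorseAut : thueMorseGroup ≃ₜ* thueMorseGroup where
  toMulEquiv := MulEquiv.ofBijective thueMorseEnd thueMorseEnd_bijective
  continuous_toFun := thueMorseEnd.continuous_toFun
  continuous_invFun := (thueMorseEnd.continuous_toFun.homeoOfEquivCompactToT2
    (f := Equiv.ofBijective thueMorseEnd thueMorseEnd_bijective)).symm.continuous

theorem thueMorsePi_bigPsi (u : FreeProfiniteGroup Gen) :
    thueMorsePi (bigPsi u) = thueMorseEnd (thueMorsePi u) := by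
  have : thueMorsePi.toMonoidHom.comp bigPsi.toMonoidHom =
      thueMorseEnd.toMonoidHom.comp thueMorsePi.toMonoidHom := by
    refine FreeProfiniteGroup.hom_ext
      (thueMorsePi.continuous_toFun.comp bigPsi.continuous_toFun)
      (thueMorseEnd.continuous_toFun.comp thueMorsePi.continuous_toFun) fun x => Subtype.ext ?_
    obtain ⟨v, hv⟩ : ∃ v, FreeProfiniteGroup.of x = returnDecode v := by
      cases x
      exacts [⟨.of .α, (returnDecode_of .α).symm⟩, ⟨.of .β, (returnDecode_of .β).symm⟩,
        ⟨.of .γ, (returnDecode_of .γ).symm⟩]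
    change (thueMorsePi (bigPsi (FreeProfiniteGroup.of x)) : FreeProfiniteSemigroup Letter) =
      extend thueMorse (extend thueMorse (thueMorsePi (FreeProfiniteGroup.of x)))
    rw [hv, bigPsi_returnDecode, thueMorsePi_returnDecode, thueMorsePi_returnDecode,
      returnCode_returnSubstitution, ← omega_extend, ← omega_extend, extend_ofWord, extend_ofWord]
  exact DFunLike.congr_fun this u

theorem thueMorsePi_omega_bigPsi (u : FreeProfiniteGroup Gen) :
    thueMorsePi (FreeProfiniteGroup.omega bigPsi u) = thueMorsePi u := by
  refine tendsto_nhds_unique ((thueMorsePi.continuous_toFun.tendsto _).comp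
    (FreeProfiniteGroup.isOmegaPower_omega bigPsi u))
    ((tendsto_thueMorseEnd_iterate (thueMorsePi u)).congr fun n => ?_)
  exact ((Function.Semiconj.iterate_right (f := thueMorsePi) (ga := bigPsi) (gb := thueMorseEnd)
    thueMorsePi_bigPsi n.factorial) u).symm

/-! ### The kernel -/

section Automaton

variable {H : Type*} [Group H]

/-- The transitions of the automaton that reads products of return words, with output in `H`.
The base state is `0`. -/
def returnStep (α β γ : H) : Fin 7 → Letter → Fin 7 × H
  | 0, .a => (1, 1)
  | 0, .b => (6, 1)
  | 1, .b => (2, 1)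
  | 2, .b => (3, 1)
  | 2, .a => (4, 1)
  -- Since abba is a prefix of abbaba, α is output as soon as abba is complete. If b follows instead
  -- of the a of a new return word, reading ba corrects the output by α⁻¹γ. Likewise βα⁻¹ is output
  -- before the α that ends ababba, and δ yields β · α⁻¹γ.
  | 3, .a => (0, α)
  | 4, .b => (5, 1)
  | 5, .b => (3, β * α⁻¹)
  | 6, .a => (0, α⁻¹ * γ)
  -- These transitions never occur on products of return words read from state 0.
  | s, _ => (s, 1)

/-- The action of words on pairs of a state and the output so far. -/
def returnRun (α β γ : H) : FreeSemigroup Letter →ₙ* (Function.End (Fin 7 × H))ᵐᵒᵖ :=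
  FreeSemigroup.lift fun x => .op fun p =>
    ((returnStep α β γ p.1 x).1, p.2 * (returnStep α β γ p.1 x).2)

/-- The state and output reached by reading a word. -/
def returnTransition (α β γ : H) (w : FreeSemigroup Letter) (p : Fin 7 × H) : Fin 7 × H :=
  (returnRun α β γ w).unop p

theorem returnTransition_of (α β γ : H) (x : Letter) (p : Fin 7 × H) :
    returnTransition α β γ (.of x) p =
      ((returnStep α β γ p.1 x).1, p.2 * (returnStep α β γ p.1 x).2) := rfl

theorem returnTransition_mul (α β γ : H) (u v : FreeSemigroup Letter) (p : Fin 7 × H) :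
    returnTransition α β γ (u * v) p =
      returnTransition α β γ v (returnTransition α β γ u p) := by
  unfold returnTransition
  rw [map_mul]
  rfl

theorem returnTransition_returnCode (f : FreeSemigroup ReturnWord →ₙ* H)
    (hδ : f (.of .δ) = f (.of .β) * (f (.of .α))⁻¹ * f (.of .γ)) (v : FreeSemigroup ReturnWord)
    (h : H) :
    returnTransition (f (.of .α)) (f (.of .β)) (f (.of .γ)) (returnCode v) (0, h) =
      (0, h * f v) := by
  induction v using FreeSemigroup.recOnMul generalizing h with
  | ih1 x =>
    cases x
    · rw [show returnCode (.of .α) = .of .a * .of .b * .of .b * .of .a from rfl]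
      simp [returnTransition_mul, returnTransition_of, returnStep, mul_assoc]
    · rw [show returnCode (.of .β) = .of .a * .of .b * .of .a * .of .b * .of .b * .of .a from rfl]
      simp [returnTransition_mul, returnTransition_of, returnStep, mul_assoc]
    · rw [show returnCode (.of .γ) = .of .a * .of .b * .of .b * .of .a * .of .b * .of .a from rfl]
      simp [returnTransition_mul, returnTransition_of, returnStep, mul_assoc]
    · rw [show returnCode (.of .δ) = .of .a * .of .b * .of .a * .of .b * .of .b * .of .a * .of .b * .of .a from rfl]
      simp [returnTransition_mul, returnTransition_of, returnStep, mul_assoc, hδ]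
  | ih2 x v hx hv =>
    rw [map_mul, returnTransition_mul, hx, hv, map_mul, mul_assoc]

end Automaton

/-- A homomorphism from products of return words to a finite group is recognized by a finite
quotient of the free semigroup. -/
theorem exists_recognizing {H : Type*} [Group H] [Finite H] (f : FreeSemigroup ReturnWord →ₙ* H)
    (hδ : f (.of .δ) = f (.of .β) * (f (.of .α))⁻¹ * f (.of .γ)) :
    ∃ (c : FiniteCongruence Letter) (o : c.Quot → H),
      ∀ v, o (proj c (ofWord (returnCode v))) = f v := by
  have : Finite (Function.End (Fin 7 × H)) := inferInstanceAs (Finite (Fin 7 × H → Fin 7 × H))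
  have : Finite (Function.End (Fin 7 × H))ᵐᵒᵖ := Finite.of_equiv _ MulOpposite.opEquiv
  let ρ := returnRun (f (.of .α)) (f (.of .β)) (f (.of .γ))
  -- The class of a word modulo the kernel of ρ fixes its action, so any representative gives the
  -- same output from (0, 1).
  refine ⟨.ker ρ, fun z => (returnTransition (f (.of .α)) (f (.of .β)) (f (.of .γ))
    (Function.surjInv (FiniteCongruence.cls_surjective _) z) (0, 1)).2, fun v => ?_⟩
  have h : ρ (Function.surjInv (FiniteCongruence.cls_surjective (.ker ρ))
      ((FiniteCongruence.ker ρ).cls (returnCode v))) = ρ (returnCode v) :=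
    (FiniteCongruence.ker ρ).cls_eq_cls.1 (Function.surjInv_eq _ _)
  have h' := congrArg Prod.snd (returnTransition_returnCode f hδ v 1)
  rw [one_mul] at h'
  refine Eq.trans ?_ h'
  exact congrArg (fun t : (Function.End (Fin 7 × H))ᵐᵒᵖ => (t.unop (0, 1)).2) h

/-! ### Presentations obtained from idempotent powers. -/

namespace FreeProfiniteGroup

theorem exists_period_omega {X : Type} [Finite X]
    (Φ : FreeProfiniteGroup X →ₜ* FreeProfiniteGroup X)
    (U : OpenNormalSubgroup (FreeProfiniteGroup X)) : ∃ N : ℕ, 0 < N ∧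
      ∀ m, 0 < m → N ∣ m → ∀ u, proj U (omega Φ u) = proj U (Φ^[m] u) := by
  refine (isOmegaPower_omega Φ).exists_period (p := proj U) continuous_quotient_mk' ?_
  refine Set.Finite.of_finite_image
    (f := fun (h : FreeProfiniteGroup X → FreeProfiniteGroup X ⧸ U.toSubgroup) (x : X) =>
      h (of x)) (Set.toFinite _) ?_
  rintro _ ⟨m, rfl⟩ _ ⟨n, rfl⟩ h
  exact congrArg DFunLike.coe (hom_ext (f := (proj U).comp (iterate Φ m))
    (g := (proj U).comp (iterate Φ n))
    (continuous_quotient_mk'.comp (Φ.continuous_toFun.iterate m))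
    (continuous_quotient_mk'.comp (Φ.continuous_toFun.iterate n)) (congrFun h))

theorem eq_one_of_proj {X : Type} {u : FreeProfiniteGroup X} (h : ∀ U, proj U u = 1) : u = 1 := by
  by_contra hne
  obtain ⟨U, hU⟩ := ProfiniteGrp.exist_openNormalSubgroup_sub_open_nhds_of_one
    (isOpen_compl_singleton (x := u)) (Ne.symm hne)
  exact hU ((QuotientGroup.eq_one_iff u).1 (h U)) rfl

/-- In a compact group a submonoid is as dense as the subgroup it generates; thus identities need
only be tested on positive words, which products of return words represent. -/
theorem dense_submonoidClosure_range_of {X : Type} :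
    Dense (Submonoid.closure (Set.range (of : X → FreeProfiniteGroup X)) :
      Set (FreeProfiniteGroup X)) := by
  rw [dense_submonoidClosure_iff_subgroupClosure]
  let e : FreeGroup X →* FreeProfiniteGroup X :=
    (ProfiniteGrp.ProfiniteCompletion.eta (GrpCat.of (FreeGroup X))).hom
  refine Dense.mono ?_ (ProfiniteGrp.ProfiniteCompletion.denseRange (GrpCat.of (FreeGroup X)))
  have h : e.range ≤ Subgroup.closure (Set.range of) := by
    rw [MonoidHom.range_eq_map, ← FreeGroup.closure_range_of, MonoidHom.map_closure,
      Subgroup.closure_le]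
    rintro _ ⟨_, ⟨x, rfl⟩, rfl⟩
    exact Subgroup.subset_closure ⟨x, rfl⟩
  rintro _ ⟨w, rfl⟩
  exact h ⟨w, rfl⟩

/-- A lifting `Φ` for which the relations `Φ^ω(x) = x` hold in the quotient and whose idempotent
power is trivial on the kernel yields a presentation. -/
theorem isProfinitePresentation_of_omega {X : Type} [Finite X] {T : Type*} [Group T]
    [TopologicalSpace T] [T1Space T] {π : FreeProfiniteGroup X →ₜ* T}
    (hπ : Function.Surjective π) {Φ : FreeProfiniteGroup X →ₜ* FreeProfiniteGroup X}
    (hΦ : ∀ u, π (omega Φ u) = π u) (hker : ∀ u, π u = 1 → omega Φ u = 1) :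
    IsProfinitePresentation π (Set.range fun x => omega Φ (of x) * (of x)⁻¹) := by
  refine ⟨hπ, le_antisymm (fun u hu => ?_) ?_⟩
  · set R := Set.range fun x => omega Φ (of x) * (of x)⁻¹
    set N := (Subgroup.normalClosure R).topologicalClosure with hN
    have hNn : N.Normal := Subgroup.is_normal_topologicalClosure _
    have hNc : IsClosed (N : Set (FreeProfiniteGroup X)) :=
      Subgroup.isClosed_topologicalClosure _
    -- The relators say exactly that Φ^ω and the identity agree modulo N on generators, hence
    -- everywhere by continuity.
    have key : (QuotientGroup.mk' N).comp (omega Φ).toMonoidHom = QuotientGroup.mk' N := by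
      refine hom_ext (continuous_quotient_mk'.comp (omega Φ).continuous_toFun)
        continuous_quotient_mk' fun x => ?_
      have hx : omega Φ (of x) * (of x)⁻¹ ∈ N :=
        Subgroup.le_topologicalClosure _ (Subgroup.subset_normalClosure ⟨x, rfl⟩)
      have := (QuotientGroup.eq_one_iff _).2 hx
      rw [QuotientGroup.mk_mul, QuotientGroup.mk_inv, mul_inv_eq_one] at this
      exact this
    have h := DFunLike.congr_fun key u
    rw [← QuotientGroup.eq_one_iff]
    refine h.symm.trans ?_
    change QuotientGroup.mk' N (omega Φ u) = 1
    rw [hker u hu, map_one]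
  · refine Subgroup.topologicalClosure_minimal _ (Subgroup.normalClosure_le_normal ?_)
      (isClosed_singleton.preimage π.continuous_toFun)
    rintro _ ⟨x, rfl⟩
    change π _ = 1
    rw [map_mul, hΦ, map_inv, mul_inv_cancel]

end FreeProfiniteGroup

/-! ### The kernel condition and the conclusion. -/

theorem omega_bigPsi_eq_one {u : FreeProfiniteGroup Gen} (hu : thueMorsePi u = 1) :
    FreeProfiniteGroup.omega bigPsi u = 1 := by
  refine FreeProfiniteGroup.eq_one_of_proj fun U => ?_
  let q := FreeProfiniteGroup.proj U
  have hq : Continuous q := continuous_quotient_mk'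
  obtain ⟨c, o, ho⟩ := exists_recognizing (q.toMulHom.comp returnDecode) (by
    change q (returnDecode _) = q (returnDecode _) * (q (returnDecode _))⁻¹ * q (returnDecode _)
    simp only [returnDecode_of, returnValue, map_mul, map_inv])
  have hrec : ∀ v, q (FreeProfiniteGroup.omega bigPsi (returnDecode v)) =
      o (proj c (thueMorsePi (returnDecode v))) := by
    intro v
    obtain ⟨M, hM, h⟩ := FreeProfiniteGroup.exists_period_omega bigPsi U
    obtain ⟨N, hN, h'⟩ := exists_period_omega thueMorse c
    -- The exponent MN computes Ψ^ω modulo U, and the matching exponent 2MN computes τ^ω modulo c,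
    -- because Ψ corresponds to τ².
    rw [h (M * N) (by positivity) (dvd_mul_right _ _), bigPsi_iterate_returnDecode,
      thueMorsePi_returnDecode, h' (2 * (M * N)) (by positivity) ⟨2 * M, by ring⟩,
      extend_iterate_ofWord, ← returnCode_returnSubstitution_iterate, ho]
    rfl
  -- The identity `hrec` concerns nonempty products only. Multiplying by α turns every element of
  -- the dense submonoid, including 1, into such a product; α is cancelled at the end.
  have hclosed : IsClosed {u | q (FreeProfiniteGroup.omega bigPsi (u * FreeProfiniteGroup.of .α)) =
      o (proj c (thueMorsePi (u * FreeProfiniteGroup.of .α)))} :=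
    isClosed_eq (hq.comp ((FreeProfiniteGroup.omega bigPsi).continuous_toFun.comp
        (continuous_id.mul continuous_const)))
      (continuous_of_discreteTopology.comp ((continuous_proj c).comp
        (continuous_coe_thueMorsePi.comp (continuous_id.mul continuous_const))))
  have hall : ∀ u, q (FreeProfiniteGroup.omega bigPsi (u * FreeProfiniteGroup.of .α)) =
      o (proj c (thueMorsePi (u * FreeProfiniteGroup.of .α))) := by
    intro u
    refine closure_minimal ?_ hclosed (FreeProfiniteGroup.dense_submonoidClosure_range_of u)
    intro m hm
    have : m = 1 ∨ ∃ v, m = returnDecode v := by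
      induction hm using Submonoid.closure_induction with
      | mem x hx =>
        obtain ⟨x, rfl⟩ := hx
        cases x
        exacts [.inr ⟨.of .α, (returnDecode_of .α).symm⟩, .inr ⟨.of .β, (returnDecode_of .β).symm⟩,
          .inr ⟨.of .γ, (returnDecode_of .γ).symm⟩]
      | one => exact .inl rfl
      | mul x y _ _ hx hy =>
        rcases hx with rfl | ⟨v, rfl⟩
        · simpa using hy
        · rcases hy with rfl | ⟨w, rfl⟩
          · exact .inr ⟨v, mul_one _⟩
          · exact .inr ⟨v * w, (map_mul _ _ _).symm⟩
    rcases this with rfl | ⟨v, rfl⟩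
    · have h := hrec (.of .α)
      rw [returnDecode_of] at h
      rw [Set.mem_ofPred_eq, one_mul]
      exact h
    · have h := hrec (v * .of .α)
      rwa [map_mul, returnDecode_of] at h
  -- As π(uα) = π(α), the elements Ψ^ω(uα) and Ψ^ω(α) have the same image under q.
  have h1 := hall u
  have h2 := hall 1
  rw [map_mul thueMorsePi, hu] at h1
  rw [map_mul thueMorsePi, map_one, ← h1, one_mul, map_mul, map_mul] at h2
  exact right_eq_mul.1 h2

theorem theoremt :
    ∃ hG : IsMaximalSubgroup thueMorseGroup,
      thueMorseGroup ⊆ substitutionJClass thueMorse ∧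
      letI : Group thueMorseGroup := hG.isSubgroup.group
      (IsTopologicalGroup thueMorseGroup ∧ CompactSpace thueMorseGroup ∧
        TotallyDisconnectedSpace thueMorseGroup) ∧
      ∃ ψ : thueMorseGroup ≃ₜ* thueMorseGroup,
        (∀ x : thueMorseGroup, (ψ x : FreeProfiniteSemigroup Letter) =
          FreeProfiniteSemigroup.extend thueMorse
            (FreeProfiniteSemigroup.extend thueMorse x)) ∧
        ∃ π : FreeProfiniteGroup Gen →ₜ* thueMorseGroup,
          (∀ x : Gen, (π (FreeProfiniteGroup.of x) : FreeProfiniteSemigroup Letter) =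
            FreeProfiniteSemigroup.omega thueMorse
              (FreeProfiniteSemigroup.ofWord (genWord x))) ∧
          bigPsi ∈ kernelLiftings (ψ : thueMorseGroup →ₜ* thueMorseGroup) π ∧
          IsProfinitePresentation π
            (Set.range fun x : Gen =>
              FreeProfiniteGroup.omega bigPsi (FreeProfiniteGroup.of x) *
                (FreeProfiniteGroup.of x)⁻¹) :=
  ⟨isMaximalSubgroup_thueMorseGroup, thueMorseGroup_subset_substitutionJClass,
    ⟨inferInstance, inferInstance, inferInstance⟩, thueMorseAut, fun _ => rfl, thueMorsePi,
    thueMorsePi_of, ⟨thueMorsePi_bigPsi, fun _ => omega_bigPsi_eq_one⟩,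
    FreeProfiniteGroup.isProfinitePresentation_of_omega thueMorsePi_surjective
      thueMorsePi_omega_bigPsi fun _ => omega_bigPsi_eq_one⟩
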